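/- Let $M$ be a Kähler manifold of complex dimension $m$ with Kähler metric $h=\sum g_{i\bar j}\,dz^i\otimes d\bar z^j$ in local holomorphic coordinates, and let $(g^{i\bar j})$ be given by $g^{i\bar l}g_{j\bar l}=\delta_{ij}$ (repeated indices are summed). Put $$\Gamma^i_{jk}=g^{i\bar l}\,\partial_k g_{j\bar l},\qquad R^l_{i\bar jk}=-\partial_{\bar j}\Gamma^l_{ik},\qquad R_{i\bar j}=R^k_{i\bar jk},\qquad R=g^{i\bar j}R_{i\bar j}.$$ Let $\phi=\phi_{12\cdots m}\,dz^1\wedge\cdots\wedge dz^m$ be a smooth $(m,0)$ form on $M$, i.e. a smooth section of the canonical bundle. Let $\nabla=\nabla^{1,0}+\nabla^{0,1}$ be the covariant derivative, with $\nabla^{1,0}\phi=\nabla_i\phi\otimes dz^i$ and $\nabla^{0,1}\phi=\nabla_{\bar i}\phi\otimes d\bar z^i$, and let $\nabla^2\phi$ be the full second covariant derivative (all components $\nabla_a\nabla_b\phi$, $a,b$ barred or unbarred). Let $\Delta$ be the complex Laplacian: $\Delta\phi=g^{i\bar j}\nabla_i\nabla_{\bar j}\phi$ on $(m,0)$ forms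 and $\Delta u=g^{i\bar j}\partial_i\partial_{\bar j}u$ on functions. Let $\langle\cdot,\cdot\rangle$ be the Hermitian inner products (linear in the first variable) induced by $\langle dz^i,dz^j\rangle=g^{i\bar j}$, $\langle d\bar z^i,d\bar z^j\rangle=\overline{g^{i\bar j}}$, $\langle dz^i,d\bar z^j\rangle=0$ and $|dz^1\wedge\cdots\wedge dz^m|^2=\det(g_{i\bar j})^{-1}$. Finally set $$Ric(\nabla^{1,0}\phi,\nabla^{1,0}\phi)=\langle R_{j\bar k}\nabla_k\phi,\nabla_j\phi\rangle,\qquad Ric(\nabla^{0,1}\phi,\nabla^{0,1}\phi)=\langle R_{k\bar j}\nabla_{\bar k}\phi,\nabla_{\bar j}\phi\rangle ,$$ where the right-hand sides are written at a point at which $g_{i\bar j}=\delta_{ij}$. Then, at every point of $M$, $$\begin{aligned}\Delta|\nabla\phi|^2={}&|\nabla^2\phi|^2+\langle\nabla\Delta\phi,\nabla\phi\rangle+\langle\nabla\phi,\nabla\Delta\phi\rangle+R|\nabla\phi|^2+\langle\phi\nabla^{1,0}R,\nabla^{1,0}\phi\rangle+\langle\nabla^{1,0}\phi,\phi\nabla^{1,0}R\rangle\\&+3\,Ric(\nabla^{1,0}\phi,\nabla^{1,0}\phi)-Ric(\nabla^{0,1}\phi,\nabla^{0,1}\phi).\end{aligned}$$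 In particular, if $M$ is Kähler–Einstein, i.e. $R_{i\bar j}=\mu g_{i\bar j}$ with a real constant $\mu$, then $R=m\mu$ and $$\Delta|\nabla\phi|^2=|\nabla^2\phi|^2+\langle\nabla\Delta\phi,\nabla\phi\rangle+\langle\nabla\phi,\nabla\Delta\phi\rangle+m\mu|\nabla\phi|^2+3\mu|\nabla^{1,0}\phi|^2-\mu|\nabla^{0,1}\phi|^2 .$$ Furthermore, if $M$ is Calabi–Yau, i.e. $\mu=0$ (equivalently $R_{i\bar j}=0$), then $$\Delta|\nabla\phi|^2=|\nabla^2\phi|^2+\langle\nabla\Delta\phi,\nabla\phi\rangle+\langle\nabla\phi,\nabla\Delta\phi\rangle .$$ -/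

import Mathlib

open scoped Manifold ContDiff ComplexConjugate

noncomputable section

namespace KahlerBochner

/-! ### Calculus in one holomorphic coordinate system

`Fin m → ℂ` is the coordinate space. Indices of the complexified tangent space are
`Fin m ⊕ Fin m`: `Sum.inl i` stands for `∂/∂zᵢ` (unbarred index) and `Sum.inr i` for
`∂/∂z̄ᵢ` (barred index). -/

/-- Wirtinger derivatives: `∂/∂zᵢ = ½ (∂/∂xᵢ - √-1 ∂/∂yᵢ)` for the index `inl i` and
`∂/∂z̄ᵢ = ½ (∂/∂xᵢ + √-1 ∂/∂yᵢ)` for the index `inr i`. -/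
def pd {m : ℕ} (a : Fin m ⊕ Fin m) (u : (Fin m → ℂ) → ℂ) (z : Fin m → ℂ) : ℂ :=
  match a with
  | .inl i => (fderiv ℝ u z (Pi.single i 1) - Complex.I * fderiv ℝ u z (Pi.single i Complex.I)) / 2
  | .inr i => (fderiv ℝ u z (Pi.single i 1) + Complex.I * fderiv ℝ u z (Pi.single i Complex.I)) / 2

/-- The matrix-valued function `z ↦ (g_{i j̄}(z))` of a Hermitian metric in coordinates. -/
abbrev LocalMetric (m : ℕ) := (Fin m → ℂ) → Matrix (Fin m) (Fin m) ℂ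

variable {m : ℕ}

/-- `g^{i j̄}`, normalized by `∑ₗ g^{i l̄} g_{j l̄} = δᵢⱼ`. -/
def gUp (G : LocalMetric m) (i j : Fin m) (z : Fin m → ℂ) : ℂ := (G z)⁻¹ j i

/-- Christoffel symbols `Γⁱⱼₖ = g^{i l̄} ∂g_{j l̄}/∂zₖ`. -/
def christoffel (G : LocalMetric m) (i j k : Fin m) (z : Fin m → ℂ) : ℂ :=
  ∑ l, gUp G i l z * pd (.inl k) (fun w => G w j l) z

/-- Christoffel symbols `Γᶜ_{a b}` of the complexified connection
(`∇_a ∂_b = ∑_c Γᶜ_{a b} ∂_c`): the only nonzero ones are `Γⁱⱼₖ` and their conjugates. -/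
def christoffelC (G : LocalMetric m) (c a b : Fin m ⊕ Fin m) (z : Fin m → ℂ) : ℂ :=
  match c, a, b with
  | .inl i, .inl j, .inl k => christoffel G i j k z
  | .inr i, .inr j, .inr k => conj (christoffel G i j k z)
  | _, _, _ => 0

/-- Curvature `Rˡ_{i j̄ k} = -∂Γˡᵢₖ/∂z̄ⱼ`. -/
def curvature (G : LocalMetric m) (l i j k : Fin m) (z : Fin m → ℂ) : ℂ :=
  - pd (.inr j) (christoffel G l i k) z

/-- Ricci curvature `R_{i j̄} = Rᵏ_{i j̄ k}`. -/
def ricci (G : LocalMetric m) (i j : Fin m) (z : Fin m → ℂ) : ℂ :=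
  ∑ k, curvature G k i j k z

/-- Scalar curvature `R = g^{i j̄} R_{i j̄}`. -/
def scalarCurv (G : LocalMetric m) (z : Fin m → ℂ) : ℂ :=
  ∑ i, ∑ j, gUp G i j z * ricci G i j z

/-- The complex Laplacian on functions, `Δu = g^{i j̄} ∂ᵢ∂_{j̄} u`. -/
def laplacian (G : LocalMetric m) (u : (Fin m → ℂ) → ℂ) (z : Fin m → ℂ) : ℂ :=
  ∑ i, ∑ j, gUp G i j z * pd (.inl i) (pd (.inr j) u) z

/-- The Hermitian inner product of the coframe of the complexified cotangent space,
`⟨dzⁱ, dzʲ⟩ = g^{i j̄}`, `⟨dz̄ⁱ, dz̄ʲ⟩ = conj (g^{i j̄})`, `⟨dzⁱ, dz̄ʲ⟩ = 0`. -/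
def gUpC (G : LocalMetric m) (a b : Fin m ⊕ Fin m) (z : Fin m → ℂ) : ℂ :=
  match a, b with
  | .inl i, .inl j => gUp G i j z
  | .inr i, .inr j => conj (gUp G i j z)
  | _, _ => 0

/-- The connection form of the canonical bundle in the frame `dz¹ ∧ ⋯ ∧ dzᵐ`:
`∇_a (dz¹ ∧ ⋯ ∧ dzᵐ) = - (∑ₖ Γᵏ_{a k}) dz¹ ∧ ⋯ ∧ dzᵐ`. -/
def connK (G : LocalMetric m) (a : Fin m ⊕ Fin m) (z : Fin m → ℂ) : ℂ :=
  ∑ k : Fin m, christoffelC G (.inl k) a (.inl k) z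

/-- Covariant derivative of the `(m,0)` form `f dz¹ ∧ ⋯ ∧ dzᵐ`: the coefficient of
`dz¹ ∧ ⋯ ∧ dzᵐ` in `∇_a (f dz¹ ∧ ⋯ ∧ dzᵐ)`. -/
def nabla (G : LocalMetric m) (f : (Fin m → ℂ) → ℂ) (a : Fin m ⊕ Fin m) (z : Fin m → ℂ) : ℂ :=
  pd a f z - connK G a z * f z

/-- Covariant derivative of a 1-form `T = ∑_b T_b dz¹ ∧ ⋯ ∧ dzᵐ ⊗ dz^b` with values in
the canonical bundle: the components `(∇T)_{a b} = ∇_a T_b`. -/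
def nabla₁ (G : LocalMetric m) (T : Fin m ⊕ Fin m → (Fin m → ℂ) → ℂ)
    (a b : Fin m ⊕ Fin m) (z : Fin m → ℂ) : ℂ :=
  pd a (T b) z - connK G a z * T b z - ∑ c, christoffelC G c a b z * T c z

/-- The second covariant derivative `∇_a ∇_b φ` of `φ = f dz¹ ∧ ⋯ ∧ dzᵐ`. -/
def nablaSq (G : LocalMetric m) (f : (Fin m → ℂ) → ℂ) (a b : Fin m ⊕ Fin m)
    (z : Fin m → ℂ) : ℂ :=
  nabla₁ G (nabla G f) a b z

/-- The complex rough Laplacian of an `(m,0)` form, `Δφ = g^{i j̄} ∇ᵢ ∇_{j̄} φ`. -/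
def laplacianK (G : LocalMetric m) (f : (Fin m → ℂ) → ℂ) (z : Fin m → ℂ) : ℂ :=
  ∑ i, ∑ j, gUp G i j z * nablaSq G f (.inl i) (.inr j) z

/-- `|dz¹ ∧ ⋯ ∧ dzᵐ|² = det (g^{i j̄}) = 1 / det (g_{i j̄})`. -/
def normSqFrame (G : LocalMetric m) (z : Fin m → ℂ) : ℂ := ((G z).det)⁻¹

/-- Hermitian inner product `⟨S, T⟩` of 1-forms with values in the canonical bundle. -/
def inner₁ (G : LocalMetric m) (S T : Fin m ⊕ Fin m → (Fin m → ℂ) → ℂ) (z : Fin m → ℂ) : ℂ :=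
  normSqFrame G z * ∑ a, ∑ b, gUpC G a b z * S a z * conj (T b z)

/-- Hermitian inner product `⟨S, T⟩` of covariant 2-tensors with values in the canonical
bundle. -/
def inner₂ (G : LocalMetric m) (S T : Fin m ⊕ Fin m → Fin m ⊕ Fin m → (Fin m → ℂ) → ℂ)
    (z : Fin m → ℂ) : ℂ :=
  normSqFrame G z *
    ∑ a, ∑ b, ∑ c, ∑ d, gUpC G a c z * gUpC G b d z * S a b z * conj (T c d z)

/-- The `(1,0)` part of a canonical-bundle-valued 1-form. -/
def part10 (T : Fin m ⊕ Fin m → (Fin m → ℂ) → ℂ) : Fin m ⊕ Fin m → (Fin m → ℂ) → ℂ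
  | .inl i => T (.inl i)
  | .inr _ => 0

/-- The `(0,1)` part of a canonical-bundle-valued 1-form. -/
def part01 (T : Fin m ⊕ Fin m → (Fin m → ℂ) → ℂ) : Fin m ⊕ Fin m → (Fin m → ℂ) → ℂ
  | .inl _ => 0
  | .inr i => T (.inr i)

/-- The Ricci endomorphism on canonical-bundle-valued 1-forms. At a point where
`g_{i j̄} = δᵢⱼ` it is `(Ric T)_j = R_{j k̄} T_k` and `(Ric T)_{j̄} = R_{k j̄} T_{k̄}`. -/
def ricciAct (G : LocalMetric m) (T : Fin m ⊕ Fin m → (Fin m → ℂ) → ℂ) :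
    Fin m ⊕ Fin m → (Fin m → ℂ) → ℂ
  | .inl j => fun z => ∑ k, ∑ l, ricci G j l z * gUp G k l z * T (.inl k) z
  | .inr j => fun z => ∑ k, ∑ l, ricci G k j z * gUp G k l z * T (.inr l) z

/-- `Ric(S, T) = ⟨Ric S, T⟩`. -/
def ricciForm (G : LocalMetric m) (S T : Fin m ⊕ Fin m → (Fin m → ℂ) → ℂ)
    (z : Fin m → ℂ) : ℂ :=
  inner₁ G (ricciAct G S) T z

/-- `φ ∇R`, with `φ = f dz¹ ∧ ⋯ ∧ dzᵐ` and `R` the scalar curvature. -/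
def mulGradScalar (G : LocalMetric m) (f : (Fin m → ℂ) → ℂ) (a : Fin m ⊕ Fin m)
    (z : Fin m → ℂ) : ℂ :=
  f z * pd a (scalarCurv G) z

/-! ### Kähler manifolds and `(m,0)` forms -/

/-- The holomorphic coordinate systems of a complex manifold. -/
abbrev holoCharts (m : ℕ) (M : Type*) [TopologicalSpace M] [ChartedSpace (Fin m → ℂ) M] :
    Set (OpenPartialHomeomorph M (Fin m → ℂ)) :=
  IsManifold.maximalAtlas 𝓘(ℂ, Fin m → ℂ) ω M

variable {M : Type*} [TopologicalSpace M] [ChartedSpace (Fin m → ℂ) M]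

/-- The coordinate vector field `∂/∂zᵢ` of the chart `e`, at the point with coordinates `z`
(the holomorphic tangent space is identified with the tangent space). -/
def coordVec (e : OpenPartialHomeomorph M (Fin m → ℂ)) (z : Fin m → ℂ) (i : Fin m) :
    TangentSpace 𝓘(ℂ, Fin m → ℂ) (e.symm z) :=
  mfderiv 𝓘(ℂ, Fin m → ℂ) 𝓘(ℂ, Fin m → ℂ) e.symm z (Pi.single i 1 : Fin m → ℂ)

/-- Components `g_{i j̄} = h(∂/∂zᵢ, ∂/∂zⱼ)` of a family of sesquilinear forms (linear in the
first, conjugate-linear in the second variable) in the chart `e`. -/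
def components
    (h : ∀ x : M, TangentSpace 𝓘(ℂ, Fin m → ℂ) x →ₗ[ℂ]
      TangentSpace 𝓘(ℂ, Fin m → ℂ) x →ₗ⋆[ℂ] ℂ)
    (e : OpenPartialHomeomorph M (Fin m → ℂ)) : LocalMetric m :=
  fun z => Matrix.of fun i j => h (e.symm z) (coordVec e z i) (coordVec e z j)

variable (m M) in
/-- A Kähler metric: a smooth Hermitian metric `h` on the tangent bundle of a complex manifold
whose Kähler form is closed. -/
structure KahlerMetric where
  /-- the Hermitian form on each tangent space -/
  herm : ∀ x : M, TangentSpace 𝓘(ℂ, Fin m → ℂ) x →ₗ[ℂ]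
    TangentSpace 𝓘(ℂ, Fin m → ℂ) x →ₗ⋆[ℂ] ℂ
  conj_symm : ∀ x v w, conj (herm x v w) = herm x w v
  pos : ∀ x v, v ≠ 0 → 0 < (herm x v v).re
  smooth : ∀ e ∈ holoCharts m M, ∀ i j,
    ContDiffOn ℝ ∞ (fun z => components herm e z i j) e.target
  /-- `dω = 0` for `ω = (√-1/2) g_{i j̄} dzⁱ ∧ dz̄ʲ`; the coefficient of `dzᵏ ∧ dzⁱ ∧ dz̄ʲ` in
  `dω` is a multiple of `∂g_{i j̄}/∂zₖ - ∂g_{k j̄}/∂zᵢ`, and the coefficients of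
  `dzⁱ ∧ dz̄ʲ ∧ dz̄ᵏ` are conjugate to these. -/
  closed : ∀ e ∈ holoCharts m M, ∀ z ∈ e.target, ∀ i j k,
    pd (.inl k) (fun w => components herm e w i j) z =
      pd (.inl i) (fun w => components herm e w k j) z

/-- The components `g_{i j̄}` of a Kähler metric in the chart `e`. -/
def KahlerMetric.inChart (g : KahlerMetric m M) (e : OpenPartialHomeomorph M (Fin m → ℂ)) :
    LocalMetric m :=
  components g.herm e

/-- `g` is Kähler–Einstein with Einstein constant `μ`: `R_{i j̄} = μ g_{i j̄}`. -/
def KahlerMetric.IsEinstein (g : KahlerMetric m M) (μ : ℝ) : Prop :=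
  ∀ e ∈ holoCharts m M, ∀ z ∈ e.target, ∀ i j,
    ricci (g.inChart e) i j z = (μ : ℂ) * g.inChart e z i j

variable (m M) in
/-- A smooth `(m,0)` form on a complex manifold of dimension `m`: a complex-multilinear
alternating form of degree `m` on each tangent space, whose coefficient `φ_{12⋯m}` is a smooth
function in every holomorphic chart. -/
structure TopForm where
  /-- the form on each tangent space -/
  form : ∀ x : M, TangentSpace 𝓘(ℂ, Fin m → ℂ) x [⋀^Fin m]→ₗ[ℂ] ℂ
  smooth : ∀ e ∈ holoCharts m M,
    ContDiffOn ℝ ∞ (fun z => form (e.symm z) (coordVec e z)) e.target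

/-- The coefficient `φ_{12⋯m} = φ(∂/∂z₁, …, ∂/∂zₘ)` in the chart `e`, so that
`φ = φ_{12⋯m} dz¹ ∧ ⋯ ∧ dzᵐ`. -/
def TopForm.coeff (φ : TopForm m M) (e : OpenPartialHomeomorph M (Fin m → ℂ))
    (z : Fin m → ℂ) : ℂ :=
  φ.form (e.symm z) (coordVec e z)

end KahlerBochner

end

open KahlerBochner

/-! In coordinates the identity is a computation at the level of germs of smooth functions, on
which the Wirtinger derivatives act as commuting derivations. The connection is compatible with
the metric, so for a tensor `S` with values in the canonical bundle
`Δ⟨S, S⟩ = |∇S|² + ⟨g^{i j̄} ∇ᵢ∇_{j̄} S, S⟩ + ⟨S, g^{i j̄} ∇_{j̄}∇ᵢ S⟩`. Apply this to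
`S = ∇^{1,0} φ` and to `S = ∇^{0,1} φ`. Exchanging `∇ᵢ` with `∇_{j̄}` produces `R S` from the
curvature of the canonical bundle, and by the Kähler symmetries of the curvature it produces
`Ric S` on (1,0)-forms and `-Ric S` on (0,1)-forms. Commuting `∇ₖ` or `∇_{k̄}` past the Laplacian
gives `g^{i j̄} ∇ᵢ∇_{j̄} ∇^{1,0} φ = ∇^{1,0} Δφ + φ ∇^{1,0} R + Ric (∇^{1,0} φ)` and
`g^{i j̄} ∇ᵢ∇_{j̄} ∇^{0,1} φ = ∇^{0,1} Δφ`. Summing up, `Ric` enters with the coefficient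
`1 + 2 = 3` in type (1,0) and `-1` in type (0,1). -/

noncomputable section

namespace KahlerBochner

open Filter
open scoped Topology

/-! ### Derivations and matrices -/

theorem derivation_prod {R A ι : Type*} [DecidableEq ι] [CommSemiring R] [CommSemiring A]
    [Algebra R A] (D : Derivation R A A) (s : Finset ι) (u : ι → A) :
    D (∏ i ∈ s, u i) = ∑ i ∈ s, D (u i) * ∏ j ∈ s.erase i, u j := by
  induction s using Finset.induction_on with
  | empty => simp
  | insert a s ha ih =>
    rw [Finset.prod_insert ha, D.leibniz, ih, Finset.sum_insert ha, Finset.erase_insert ha,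
      smul_eq_mul, smul_eq_mul, Finset.mul_sum, add_comm, mul_comm]
    congr 1
    refine Finset.sum_congr rfl fun i hi => ?_
    have hai : a ≠ i := (ne_of_mem_of_not_mem hi ha).symm
    rw [Finset.erase_insert_of_ne hai, Finset.prod_insert (by simp [ha]), mul_left_comm]

theorem derivation_det {R A n : Type*} [Fintype n] [DecidableEq n] [CommRing R] [CommRing A]
    [Algebra R A] (D : Derivation R A A) (M : Matrix n n A) :
    D M.det = ∑ i, ∑ j, M.adjugate i j * D (M j i) := by
  have hcol (i : n) : ∑ j, M.adjugate i j * D (M j i) =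
      (M.updateCol i fun j => D (M j i)).det := by
    rw [← Matrix.cramer_apply, Matrix.cramer_eq_adjugate_mulVec]
    rfl
  simp_rw [hcol, Matrix.det_apply', map_sum]
  rw [Finset.sum_comm]
  refine Finset.sum_congr rfl fun σ _ => ?_
  rw [D.leibniz, D.map_intCast, smul_zero, add_zero, derivation_prod, smul_eq_mul,
    Finset.mul_sum]
  refine Finset.sum_congr rfl fun i _ => ?_
  rw [← Finset.mul_prod_erase _ _ (Finset.mem_univ i), Matrix.updateCol_self]
  congr 2
  exact Finset.prod_congr rfl fun j hj =>
    (Matrix.updateCol_ne (Finset.ne_of_mem_erase hj)).symm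

lemma map_derivation_mul {R A l m n : Type*} [Fintype m] [CommSemiring R] [CommSemiring A]
    [Algebra R A] (D : Derivation R A A) (M : Matrix l m A) (N : Matrix m n A) :
    (M * N).map D = M.map D * N + M * N.map D := by
  ext i j
  simp only [Matrix.map_apply, Matrix.mul_apply, Matrix.add_apply, map_sum, D.leibniz,
    smul_eq_mul, Finset.sum_add_distrib]
  rw [add_comm]
  simp only [mul_comm]

lemma map_derivation_inv {R A n : Type*} [Fintype n] [DecidableEq n] [CommRing R] [CommRing A]
    [Algebra R A] (D : Derivation R A A) {M : Matrix n n A} (hM : IsUnit M.det) :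
    M⁻¹.map D = -(M⁻¹ * M.map D * M⁻¹) := by
  have h : M⁻¹.map D * M + M⁻¹ * M.map D = 0 := by
    rw [← map_derivation_mul, Matrix.nonsing_inv_mul _ hM]
    ext i j
    rw [Matrix.map_apply, Matrix.one_apply]
    split_ifs <;> simp
  rw [← neg_mul, ← eq_neg_of_add_eq_zero_left h, mul_assoc, Matrix.mul_nonsing_inv _ hM, mul_one]

/-! ### Kähler geometry over a ring with derivations -/

/-- A pseudo-Kähler metric over a commutative ring `A` with involution: `A` plays the role of the
ring of smooth functions of `z₁, …, zₘ`, and only the algebraic properties of the Wirtinger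
derivatives and of the metric are kept. Indices are as in `pd`. -/
structure FormalKahlerMetric (n A : Type*) [Fintype n] [DecidableEq n] [CommRing A]
    [StarRing A] where
  /-- the Wirtinger derivatives -/
  D : n ⊕ n → Derivation ℤ A A
  D_comm : ∀ a b u, D a (D b u) = D b (D a u)
  star_D : ∀ a u, star (D a u) = D a.swap (star u)
  /-- the metric `g_{i j̄}` -/
  g : Matrix n n A
  isHermitian : g.IsHermitian
  isUnit_det : IsUnit g.det
  closed : ∀ i j k, D (.inl k) (g i j) = D (.inl i) (g k j)

namespace FormalKahlerMetric

section Calculus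

variable {n A E F : Type*} [Fintype n] [DecidableEq n] [CommRing A] [StarRing A]
  [AddCommGroup E] [Module A E] [AddCommGroup F] [Module A F] (K : FormalKahlerMetric n A)

lemma D_mul (a : n ⊕ n) (u v : A) : K.D a (u * v) = K.D a u * v + u * K.D a v := by
  rw [Derivation.leibniz, smul_eq_mul, smul_eq_mul]; ring

/-- The inverse metric `g^{i j̄}`. -/
def gInv : Matrix n n A := (K.g⁻¹).transpose

/-- The trace `g^{i j̄} Z_{i j̄}`. -/
def tr (Z : n → n → E) : E := ∑ i, ∑ j, K.gInv i j • Z i j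

lemma gInv_mul_transpose : K.gInv * K.g.transpose = 1 := by
  rw [gInv, ← Matrix.transpose_mul, Matrix.mul_nonsing_inv _ K.isUnit_det, Matrix.transpose_one]

lemma transpose_mul_gInv : K.g.transpose * K.gInv = 1 :=
  mul_eq_one_comm.mp K.gInv_mul_transpose

lemma sum_gInv_mul_g (i k : n) : ∑ j, K.gInv i j * K.g k j = (1 : Matrix n n A) i k := by
  rw [← K.gInv_mul_transpose]; rfl

lemma star_g (i j : n) : star (K.g i j) = K.g j i := K.isHermitian.apply j i

lemma isHermitian_gInv : K.gInv.IsHermitian := K.isHermitian.inv.transpose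

lemma star_gInv (i j : n) : star (K.gInv i j) = K.gInv j i := K.isHermitian_gInv.apply j i

lemma tr_add (Y Z : n → n → E) : K.tr (fun i j => Y i j + Z i j) = K.tr Y + K.tr Z := by
  simp only [tr, smul_add, Finset.sum_add_distrib]

lemma tr_sub (Y Z : n → n → E) : K.tr (fun i j => Y i j - Z i j) = K.tr Y - K.tr Z := by
  simp only [tr, smul_sub, Finset.sum_sub_distrib]

lemma tr_sum {ι : Type*} (s : Finset ι) (Z : ι → n → n → E) :
    K.tr (fun i j => ∑ c ∈ s, Z c i j) = ∑ c ∈ s, K.tr (Z c) := by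
  simp only [tr, Finset.smul_sum]
  rw [Finset.sum_comm (s := s)]
  exact Finset.sum_congr rfl fun i _ => Finset.sum_comm

lemma tr_swap (Z : n → n → E) :
    K.tr (fun i j => Z j i) = ∑ i, ∑ j, star (K.gInv i j) • Z i j := by
  simp only [tr, star_gInv]
  exact Finset.sum_comm

lemma map_tr (L : E →ₗ[A] F) (Z : n → n → E) : L (K.tr Z) = K.tr fun i j => L (Z i j) := by
  simp only [tr, map_sum, map_smul]

lemma map_tr_conj (L : E →ₗ⋆[A] F) (Z : n → n → E) :
    L (K.tr Z) = K.tr fun i j => L (Z j i) := by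
  rw [K.tr_swap fun i j => L (Z i j)]
  simp only [tr, map_sum, map_smulₛₗ, starRingEnd_apply]

lemma tr_apply {ι : Type*} (Z : n → n → ι → A) (k : ι) : K.tr Z k = K.tr fun i j => Z i j k :=
  K.map_tr (LinearMap.proj k) Z

lemma mul_tr (a : A) (Z : n → n → A) : a * K.tr Z = K.tr fun i j => a * Z i j :=
  K.map_tr (LinearMap.mulLeft A a) Z

lemma star_tr (Z : n → n → A) : star (K.tr Z) = K.tr fun i j => star (Z j i) :=
  K.map_tr_conj (starLinearEquiv A : A ≃ₗ⋆[A] A).toLinearMap Z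

lemma tr_comm (Z : n → n → n → n → A) :
    K.tr (fun i j => K.tr fun k l => Z i j k l) = K.tr fun k l => K.tr fun i j => Z i j k l := by
  change K.tr (fun i j => ∑ k, ∑ l, K.gInv k l * Z i j k l) = _
  simp only [tr_sum, ← mul_tr]
  rfl

/-- The Christoffel symbols `Γᵢⱼₖ` with upper index `i`. -/
def chr (i j k : n) : A := ∑ l, K.gInv i l * K.D (.inl k) (K.g j l)

/-- The trace `Γᵏᵢₖ`, which is the connection form of the dual of the canonical bundle. -/
def chrTr (i : n) : A := ∑ k, K.chr k i k

/-- The curvature `Rˡ_{i j̄ k}`. -/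
def curv (l i j k : n) : A := -K.D (.inr j) (K.chr l i k)

/-- The Ricci curvature `R_{i j̄}`. -/
def ricci (i j : n) : A := ∑ k, K.curv k i j k

/-- The scalar curvature `g^{i j̄} R_{i j̄}`. -/
def scal : A := K.tr K.ricci

/-- The squared norm `det (g^{i j̄})` of the frame `dz¹ ∧ ⋯ ∧ dzᵐ` of the canonical bundle. -/
def normSq : A := K.gInv.det

lemma chr_symm (i j k : n) : K.chr i j k = K.chr i k j := by
  simp only [chr, K.closed j _ k]

lemma ricci_eq (i j : n) : K.ricci i j = -K.D (.inr j) (K.chrTr i) := by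
  simp only [ricci, curv, chrTr, map_sum, Finset.sum_neg_distrib]

lemma D_gInv_inl (k i j : n) :
    K.D (.inl k) (K.gInv i j) = -∑ p, K.chr i p k * K.gInv p j := by
  have h := congr_fun₂ (map_derivation_inv (K.D (.inl k)) K.isUnit_det) j i
  rw [mul_assoc, Matrix.neg_apply, ← Matrix.transpose_apply (_ * _), Matrix.transpose_mul,
    Matrix.transpose_mul, Matrix.mul_apply] at h
  simp only [Matrix.mul_apply] at h
  exact h

/-- The covariant derivative `∇_a Z_{i j̄}` of a (1,1)-tensor. -/
def cov11 (a : n ⊕ n) (Z : n → n → A) (i j : n) : A :=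
  match a with
  | .inl k => K.D (.inl k) (Z i j) - ∑ c, K.chr c i k * Z c j
  | .inr k => K.D (.inr k) (Z i j) - ∑ c, star (K.chr c j k) * Z i c

lemma D_tr_inl (k : n) (Z : n → n → A) : K.D (.inl k) (K.tr Z) = K.tr (K.cov11 (.inl k) Z) := by
  change _ = K.tr fun i j => K.D (.inl k) (Z i j) - ∑ c, K.chr c i k * Z c j
  rw [tr_sub, tr_sum]
  simp only [tr, smul_eq_mul, map_sum, D_mul, D_gInv_inl, Finset.sum_add_distrib]
  rw [add_comm, sub_eq_add_neg]
  congr 1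
  simp only [neg_mul, Finset.sum_neg_distrib, neg_inj, Finset.sum_mul]
  refine Finset.sum_congr rfl fun i _ => ?_
  rw [Finset.sum_comm]
  exact Finset.sum_congr rfl fun p _ => Finset.sum_congr rfl fun j _ => by ring

lemma star_cov11 (a : n ⊕ n) (Z : n → n → A) (i j : n) :
    star (K.cov11 a Z i j) = K.cov11 a.swap (fun i j => star (Z j i)) j i := by
  cases a <;> simp [cov11, star_D]

lemma D_tr (a : n ⊕ n) (Z : n → n → A) : K.D a (K.tr Z) = K.tr (K.cov11 a Z) := by
  rcases a with k | k
  · exact K.D_tr_inl k Z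
  · have h := congrArg star (K.D_tr_inl k fun i j => star (Z j i))
    simpa only [star_D, star_tr, star_cov11, star_star, Sum.swap_inl] using h

lemma isUnit_normSq : IsUnit K.normSq :=
  (Matrix.isUnit_iff_isUnit_det _).mp (IsUnit.of_mul_eq_one _ K.gInv_mul_transpose)

lemma star_normSq : star K.normSq = K.normSq := by
  rw [normSq, ← Matrix.det_conjTranspose, K.isHermitian_gInv]

lemma D_normSq_inl (k : n) : K.D (.inl k) K.normSq = -(K.chrTr k * K.normSq) := by
  have hadj : K.gInv.adjugate = K.normSq • K.g.transpose := by
    rw [← mul_one K.gInv.adjugate, ← K.gInv_mul_transpose, ← mul_assoc, Matrix.adjugate_mul,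
      Matrix.smul_mul, one_mul, normSq]
  calc K.D (.inl k) K.normSq
    _ = -(K.normSq * ∑ i, ∑ j, ∑ p, K.g j i * (K.chr j p k * K.gInv p i)) := by
      rw [normSq, derivation_det, hadj, ← normSq]
      simp only [D_gInv_inl, Matrix.smul_apply, Matrix.transpose_apply, smul_eq_mul, mul_neg,
        Finset.sum_neg_distrib, Finset.mul_sum, mul_assoc]
    _ = -(K.normSq * ∑ j, ∑ p, K.chr j p k * ∑ i, K.gInv p i * K.g j i) := by
      rw [Finset.sum_comm]
      simp only [Finset.mul_sum]
      refine congrArg Neg.neg (Finset.sum_congr rfl fun j _ => ?_)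
      rw [Finset.sum_comm]
      exact Finset.sum_congr rfl fun p _ => Finset.sum_congr rfl fun i _ => by ring
    _ = -(K.chrTr k * K.normSq) := by
      simp only [sum_gInv_mul_g, Matrix.one_apply, mul_ite, mul_one, mul_zero, Finset.sum_ite_eq',
        Finset.mem_univ, if_true, chrTr, K.chr_symm _ k, mul_comm K.normSq]

lemma D_normSq_inr (k : n) : K.D (.inr k) K.normSq = -(star (K.chrTr k) * K.normSq) := by
  have h := congrArg star (K.D_normSq_inl k)
  rw [star_D, star_neg, star_mul', star_normSq] at h
  exact h

lemma D_inl_chrTr_comm (i k : n) :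
    K.D (.inl i) (K.chrTr k) = K.D (.inl k) (K.chrTr i) := by
  apply K.isUnit_normSq.mul_left_cancel
  have h := K.D_comm (.inl i) (.inl k) K.normSq
  simp only [D_normSq_inl, map_neg, D_mul] at h
  linear_combination -h

lemma D_inl_ricci_comm (i j k : n) :
    K.D (.inl i) (K.ricci k j) = K.D (.inl k) (K.ricci i j) := by
  simp only [ricci_eq, map_neg, K.D_comm (.inl _), K.D_inl_chrTr_comm i k]

lemma star_ricci (i j : n) : star (K.ricci i j) = K.ricci j i := by
  apply K.isUnit_normSq.mul_left_cancel
  have h := K.D_comm (.inl j) (.inr i) K.normSq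
  simp only [D_normSq_inl, D_normSq_inr, map_neg, D_mul] at h
  simp only [ricci_eq, star_neg, star_D, Sum.swap_inr]
  linear_combination h

lemma star_scal : star K.scal = K.scal := by
  simp only [scal, star_tr, star_ricci]

/-- The curvature `R_{i j̄ k q̄}` with all indices lowered. -/
def curvLow (i j k q : n) : A := ∑ c, K.curv c i j k * K.g c q

lemma sum_gInv_mul_sum_mul_g (x : n → A) (c : n) :
    ∑ q, K.gInv c q * ∑ p, x p * K.g p q = x c := by
  have h : (K.gInv.mulVec (K.g.transpose.mulVec x)) c = x c := by
    rw [Matrix.mulVec_mulVec, gInv_mul_transpose, Matrix.one_mulVec]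
  simpa only [Matrix.mulVec, dotProduct, Matrix.transpose_apply, mul_comm (x _)] using h

lemma sum_chr_mul_g (i k q : n) : ∑ c, K.chr c i k * K.g c q = K.D (.inl k) (K.g i q) := by
  have h : (K.g.transpose.mulVec (K.gInv.mulVec fun l => K.D (.inl k) (K.g i l))) q =
      K.D (.inl k) (K.g i q) := by
    rw [Matrix.mulVec_mulVec, transpose_mul_gInv, Matrix.one_mulVec]
  simpa only [chr, Matrix.mulVec, dotProduct, Matrix.transpose_apply, mul_comm (K.g _ _)] using h

lemma D_inr_g_comm (i j k : n) : K.D (.inr k) (K.g i j) = K.D (.inr j) (K.g i k) := by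
  simpa only [star_D, star_g, Sum.swap_inl] using congrArg star (K.closed j i k)

lemma curvLow_eq (i j k q : n) : K.curvLow i j k q =
    ∑ c, K.chr c i k * K.D (.inr j) (K.g c q) - K.D (.inr j) (K.D (.inl k) (K.g i q)) := by
  rw [← sum_chr_mul_g, map_sum, ← Finset.sum_sub_distrib]
  exact Finset.sum_congr rfl fun c _ => by rw [D_mul, curv]; ring

lemma curvLow_symm_right (i j k q : n) : K.curvLow i j k q = K.curvLow i q k j := by
  simp only [curvLow_eq, K.D_comm (.inr _), K.D_inr_g_comm _ q j]

lemma curv_symm (l i j k : n) : K.curv l i j k = K.curv l k j i := by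
  rw [curv, curv, chr_symm]

lemma tr_curvLow (k q : n) : K.tr (fun i j => K.curvLow i q k j) = K.ricci k q := by
  refine Finset.sum_congr rfl fun i _ => ?_
  rw [K.curv_symm i k q i]
  exact K.sum_gInv_mul_sum_mul_g (fun p => K.curv p i q k) i

lemma tr_curv (c k : n) :
    K.tr (fun i j => K.curv c i j k) = ∑ l, K.gInv c l * K.ricci k l :=
  calc K.tr (fun i j => K.curv c i j k)
    _ = K.tr fun i j => ∑ q, K.gInv c q * K.curvLow i q k j := by
      congr! 3 with i j
      simp only [K.curvLow_symm_right i _ k j]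
      exact (K.sum_gInv_mul_sum_mul_g (fun p => K.curv p i j k) c).symm
    _ = ∑ l, K.gInv c l * K.ricci k l := by
      simp only [tr_sum, ← mul_tr, tr_curvLow]

/-- The components `∇ᵢφ` of the covariant derivative of a section `φ = f dz¹ ∧ ⋯ ∧ dzᵐ`. -/
def grad10 (f : A) : n → A := fun i => K.D (.inl i) f - K.chrTr i * f

/-- The components `∇_{j̄}φ` of the covariant derivative of a section `φ = f dz¹ ∧ ⋯ ∧ dzᵐ`. -/
def grad01 (f : A) : n → A := fun i => K.D (.inr i) f

/-- The covariant derivative `∇_a T` of a (1,0)-form `T` with values in the canonical bundle. -/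
def cov10 (a : n ⊕ n) (T : n → A) : n → A :=
  match a with
  | .inl i => fun k => K.D (.inl i) (T k) - K.chrTr i * T k - ∑ c, K.chr c i k * T c
  | .inr i => fun k => K.D (.inr i) (T k)

/-- The covariant derivative `∇_a T` of a (0,1)-form `T` with values in the canonical bundle. -/
def cov01 (a : n ⊕ n) (T : n → A) : n → A :=
  match a with
  | .inl i => fun k => K.D (.inl i) (T k) - K.chrTr i * T k
  | .inr i => fun k => K.D (.inr i) (T k) - ∑ c, star (K.chr c i k) * T c

/-- The Hermitian inner product of (1,0)-forms with values in the canonical bundle. -/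
def inner10 : (n → A) →ₗ[A] (n → A) →ₗ⋆[A] A :=
  Matrix.toLinearMapₛₗ₂' A (RingHom.id A) (starRingEnd A) (K.normSq • K.gInv)

/-- The Hermitian inner product of (0,1)-forms with values in the canonical bundle. -/
def inner01 : (n → A) →ₗ[A] (n → A) →ₗ⋆[A] A :=
  Matrix.toLinearMapₛₗ₂' A (RingHom.id A) (starRingEnd A) (K.normSq • K.gInv.transpose)

lemma inner10_apply (S T : n → A) :
    K.inner10 S T = K.normSq * K.tr fun i j => S i * star (T j) := by
  simp only [inner10, Matrix.toLinearMapₛₗ₂'_apply, tr, Finset.mul_sum, Matrix.smul_apply,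
    RingHom.id_apply, starRingEnd_apply, smul_eq_mul]
  exact Finset.sum_congr rfl fun i _ => Finset.sum_congr rfl fun j _ => by ring

lemma inner01_apply (S T : n → A) :
    K.inner01 S T = K.normSq * K.tr fun i j => S j * star (T i) := by
  simp only [inner01, Matrix.toLinearMapₛₗ₂'_apply, tr, Finset.mul_sum, Matrix.smul_apply,
    Matrix.transpose_apply, RingHom.id_apply, starRingEnd_apply, smul_eq_mul]
  rw [Finset.sum_comm]
  exact Finset.sum_congr rfl fun i _ => Finset.sum_congr rfl fun j _ => by ring

lemma star_inner10 (S T : n → A) : star (K.inner10 S T) = K.inner10 T S := by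
  simp only [inner10_apply, star_mul', star_tr, star_normSq, star_star, mul_comm (S _)]

lemma star_inner01 (S T : n → A) : star (K.inner01 S T) = K.inner01 T S := by
  simp only [inner01_apply, star_mul', star_tr, star_normSq, star_star, mul_comm (S _)]

lemma D_normSq_mul_tr_inl (k : n) (Z : n → n → A) :
    K.D (.inl k) (K.normSq * K.tr Z) =
      K.normSq * K.tr fun i j => K.cov11 (.inl k) Z i j - K.chrTr k * Z i j := by
  rw [D_mul, D_normSq_inl, D_tr, tr_sub, ← mul_tr]
  ring

lemma D_inner10 (a : n ⊕ n) (S T : n → A) :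
    K.D a (K.inner10 S T) = K.inner10 (K.cov10 a S) T + K.inner10 S (K.cov10 a.swap T) := by
  have inl (k : n) (S T : n → A) : K.D (.inl k) (K.inner10 S T) =
      K.inner10 (K.cov10 (.inl k) S) T + K.inner10 S (K.cov10 (.inr k) T) := by
    simp only [inner10_apply, D_normSq_mul_tr_inl, ← mul_add, ← tr_add]
    congr! 4 with i j
    simp only [cov11, cov10, D_mul, star_D, Sum.swap_inr, sub_mul, Finset.sum_mul, mul_assoc,
      K.chr_symm _ k]
    ring
  rcases a with k | k
  · exact inl k S T
  · have h := congrArg star (inl k T S)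
    rwa [star_D, star_add, star_inner10, star_inner10, star_inner10, add_comm] at h

lemma D_inner01 (a : n ⊕ n) (S T : n → A) :
    K.D a (K.inner01 S T) = K.inner01 (K.cov01 a S) T + K.inner01 S (K.cov01 a.swap T) := by
  have inl (k : n) (S T : n → A) : K.D (.inl k) (K.inner01 S T) =
      K.inner01 (K.cov01 (.inl k) S) T + K.inner01 S (K.cov01 (.inr k) T) := by
    simp only [inner01_apply, D_normSq_mul_tr_inl, ← mul_add, ← tr_add]
    congr! 4 with i j
    simp only [cov11, cov01, D_mul, star_sub, star_sum, star_mul', star_star, star_D,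
      Sum.swap_inr, sub_mul, mul_sub, Finset.mul_sum, mul_assoc, mul_left_comm (S _),
      K.chr_symm _ k]
    ring
  rcases a with k | k
  · exact inl k S T
  · have h := congrArg star (inl k T S)
    rwa [star_D, star_add, star_inner01, star_inner01, star_inner01, add_comm] at h

/-- The Laplacian `Δu = g^{i j̄} ∂ᵢ∂_{j̄} u` of a function. -/
def lap (u : A) : A := K.tr fun i j => K.D (.inl i) (K.D (.inr j) u)

theorem lap_of_metric_compatible (B : E →ₗ[A] E →ₗ⋆[A] A) (cov : n ⊕ n → E → E)
    (hB : ∀ a S T, K.D a (B S T) = B (cov a S) T + B S (cov a.swap T)) (S : E) :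
    K.lap (B S S) =
      K.tr (fun i j => B (cov (.inl i) S) (cov (.inl j) S)) +
      K.tr (fun i j => B (cov (.inr j) S) (cov (.inr i) S)) +
      B (K.tr fun i j => cov (.inl i) (cov (.inr j) S)) S +
      B S (K.tr fun i j => cov (.inr j) (cov (.inl i) S)) := by
  rw [← LinearMap.flip_apply B (K.tr _) S, map_tr, map_tr_conj]
  simp only [lap, hB, map_add, tr_add, LinearMap.flip_apply, Sum.swap_inl, Sum.swap_inr]
  ring

/-- The mixed second derivatives `∇ᵢ∇_{j̄} φ`. -/
def hess (f : A) (i j : n) : A := K.cov01 (.inl i) (K.grad01 f) j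

/-- The Laplacian `g^{i j̄} ∇ᵢ∇_{j̄} φ` of a section of the canonical bundle. -/
def lapSection (f : A) : A := K.tr (K.hess f)

/-- The Ricci endomorphism of (1,0)-forms. -/
def ric10 (T : n → A) : n → A := fun j => K.tr fun k l => K.ricci j l * T k

/-- The Ricci endomorphism of (0,1)-forms. -/
def ric01 (T : n → A) : n → A := fun j => K.tr fun k l => K.ricci k j * T l

lemma cov10_inr_grad10 (f : A) (j k : n) :
    K.cov10 (.inr j) (K.grad10 f) k = K.hess f k j + f * K.ricci k j := by
  simp only [cov10, grad10, grad01, hess, cov01, map_sub, D_mul, ricci_eq, K.D_comm (.inr j)]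
  ring

lemma cov10_inr_cov10_inl (T : n → A) (i j k : n) :
    K.cov10 (.inr j) (K.cov10 (.inl i) T) k = K.cov10 (.inl i) (K.cov10 (.inr j) T) k +
      K.ricci i j * T k + ∑ c, K.curv c i j k * T c := by
  simp only [cov10, curv, ricci_eq, map_sub, map_sum, D_mul, K.D_comm (.inr j),
    Finset.sum_add_distrib, neg_mul, Finset.sum_neg_distrib]
  ring

lemma cov01_inr_cov01_inl (T : n → A) (i j k : n) :
    K.cov01 (.inr j) (K.cov01 (.inl i) T) k = K.cov01 (.inl i) (K.cov01 (.inr j) T) k +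
      K.ricci i j * T k - ∑ c, star (K.curv c j i k) * T c := by
  simp only [cov01, curv, ricci_eq, star_neg, star_D, map_sub, map_sum, D_mul, Sum.swap_inr,
    K.D_comm (.inr j), Finset.sum_add_distrib, mul_sub, Finset.sum_sub_distrib, Finset.mul_sum,
    neg_mul, Finset.sum_neg_distrib, mul_left_comm (K.chrTr i)]
  ring

lemma sum_tr_curv_mul (T : n → A) (k : n) :
    ∑ c, K.tr (fun i j => K.curv c i j k) * T c = K.ric10 T k := by
  simp only [tr_curv, ric10, Finset.sum_mul]
  simp only [tr, smul_eq_mul, mul_assoc]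

lemma sum_star_tr_curv_mul (T : n → A) (k : n) :
    ∑ c, star (K.tr fun i j => K.curv c i j k) * T c = K.ric01 T k := by
  simp only [tr_curv, ric01, star_sum, star_mul', star_ricci, star_gInv, Finset.sum_mul]
  simp only [tr, smul_eq_mul, mul_assoc]
  exact Finset.sum_comm

theorem tr_cov10_inr_cov10_inl (T : n → A) :
    K.tr (fun i j => K.cov10 (.inr j) (K.cov10 (.inl i) T)) =
      K.tr (fun i j => K.cov10 (.inl i) (K.cov10 (.inr j) T)) + K.scal • T + K.ric10 T := by
  ext k
  simp only [Pi.add_apply, Pi.smul_apply, tr_apply, cov10_inr_cov10_inl, tr_add, tr_sum]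
  simp only [mul_comm _ (T _), ← mul_tr, scal, smul_eq_mul, ← sum_tr_curv_mul]

theorem tr_cov01_inr_cov01_inl (T : n → A) :
    K.tr (fun i j => K.cov01 (.inr j) (K.cov01 (.inl i) T)) =
      K.tr (fun i j => K.cov01 (.inl i) (K.cov01 (.inr j) T)) + K.scal • T - K.ric01 T := by
  ext k
  simp only [Pi.add_apply, Pi.sub_apply, Pi.smul_apply, tr_apply, cov01_inr_cov01_inl, tr_add,
    tr_sub, tr_sum]
  simp only [mul_comm _ (T _), ← mul_tr, scal, smul_eq_mul, ← sum_star_tr_curv_mul, star_tr]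

lemma cov11_inl_ricci_comm (i j k : n) :
    K.cov11 (.inl i) K.ricci k j = K.cov11 (.inl k) K.ricci i j := by
  simp only [cov11, K.D_inl_ricci_comm i, K.chr_symm _ i]

lemma cov11_inl_hess_comm (f : A) (i j k : n) :
    K.cov11 (.inl i) (K.hess f) k j - K.chrTr i * K.hess f k j =
      K.cov11 (.inl k) (K.hess f) i j - K.chrTr k * K.hess f i j := by
  simp only [cov11, hess, cov01, map_sub, D_mul, K.D_comm (.inl i), K.D_inl_chrTr_comm i,
    K.chr_symm _ i]
  ring

lemma cov10_inl_cov10_inr_grad10 (f : A) (i j k : n) :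
    K.cov10 (.inl i) (K.cov10 (.inr j) (K.grad10 f)) k =
      K.cov11 (.inl k) (K.hess f) i j - K.chrTr k * K.hess f i j +
      f * K.cov11 (.inl k) K.ricci i j + K.ricci k j * K.grad10 f i := by
  rw [← cov11_inl_hess_comm, ← cov11_inl_ricci_comm, funext (K.cov10_inr_grad10 f j)]
  simp only [cov10, cov11, grad10, map_add, D_mul, mul_add, mul_sub, Finset.sum_add_distrib,
    Finset.mul_sum, mul_left_comm f, K.chr_symm _ i k]
  ring

theorem tr_cov10_inl_cov10_inr_grad10 (f : A) :
    K.tr (fun i j => K.cov10 (.inl i) (K.cov10 (.inr j) (K.grad10 f))) =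
      K.grad10 (K.lapSection f) + (f • fun k => K.D (.inl k) K.scal) + K.ric10 (K.grad10 f) := by
  ext k
  simp only [tr_apply, cov10_inl_cov10_inr_grad10, tr_add, tr_sub, ← mul_tr, ← D_tr]
  rfl

lemma cov01_inr_grad01_comm (f : A) (j k : n) :
    K.cov01 (.inr j) (K.grad01 f) k = K.cov01 (.inr k) (K.grad01 f) j := by
  simp only [cov01, grad01, K.D_comm (.inr j), K.chr_symm _ j]

lemma cov01_inl_cov01_inr_grad01 (f : A) (i j k : n) :
    K.cov01 (.inl i) (K.cov01 (.inr j) (K.grad01 f)) k =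
      K.cov11 (.inr k) (K.hess f) i j - K.ricci i k * K.grad01 f j +
      ∑ c, star (K.curv c j i k) * K.grad01 f c := by
  have hcomm := K.cov01_inr_cov01_inl (K.grad01 f) i k j
  simp only [K.curv_symm _ k i j] at hcomm
  have hswap : K.cov01 (.inl i) (K.cov01 (.inr j) (K.grad01 f)) k =
      K.cov01 (.inl i) (K.cov01 (.inr k) (K.grad01 f)) j := by
    change K.D (.inl i) (K.cov01 (.inr j) (K.grad01 f) k) - K.chrTr i * _ = _
    rw [K.cov01_inr_grad01_comm]
    rfl
  have hhess : K.cov11 (.inr k) (K.hess f) i j =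
      K.cov01 (.inr k) (K.cov01 (.inl i) (K.grad01 f)) j := by
    change _ = K.D (.inr k) _ - ∑ c, star (K.chr c k j) * _
    simp only [cov11, hess, K.chr_symm _ k]
  rw [hswap, hhess, hcomm]
  ring

theorem tr_cov01_inl_cov01_inr_grad01 (f : A) :
    K.tr (fun i j => K.cov01 (.inl i) (K.cov01 (.inr j) (K.grad01 f))) =
      K.grad01 (K.lapSection f) := by
  ext k
  have hcurv : ∑ c, K.tr (fun i j => star (K.curv c j i k) * K.grad01 f c) =
      K.ric01 (K.grad01 f) k := by
    simp only [← sum_star_tr_curv_mul, star_tr, mul_comm _ (K.grad01 f _), mul_tr]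
  simp only [tr_apply, cov01_inl_cov01_inr_grad01, tr_add, tr_sub, tr_sum, ← D_tr, hcurv]
  exact sub_add_cancel _ _

lemma inner10_ric10_comm (S T : n → A) :
    K.inner10 (K.ric10 S) T = K.inner10 S (K.ric10 T) := by
  simp only [inner10_apply, ric10, star_tr, star_mul', star_ricci, mul_comm _ (star (T _)), mul_tr]
  rw [tr_comm]
  congr! 6
  ring

lemma inner01_ric01_comm (S T : n → A) :
    K.inner01 (K.ric01 S) T = K.inner01 S (K.ric01 T) := by
  simp only [inner01_apply, ric01, star_tr, star_mul', star_ricci, mul_comm _ (star (T _)), mul_tr]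
  rw [tr_comm]
  congr! 6
  ring

theorem lap_inner10_grad10 (f : A) :
    K.lap (K.inner10 (K.grad10 f) (K.grad10 f)) =
      K.tr (fun i j => K.inner10 (K.cov10 (.inl i) (K.grad10 f)) (K.cov10 (.inl j) (K.grad10 f))) +
      K.tr (fun i j => K.inner10 (K.cov10 (.inr j) (K.grad10 f)) (K.cov10 (.inr i) (K.grad10 f))) +
      K.inner10 (K.grad10 (K.lapSection f)) (K.grad10 f) +
      K.inner10 (K.grad10 f) (K.grad10 (K.lapSection f)) +
      K.scal * K.inner10 (K.grad10 f) (K.grad10 f) +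
      K.inner10 (f • fun k => K.D (.inl k) K.scal) (K.grad10 f) +
      K.inner10 (K.grad10 f) (f • fun k => K.D (.inl k) K.scal) +
      3 * K.inner10 (K.ric10 (K.grad10 f)) (K.grad10 f) := by
  rw [K.lap_of_metric_compatible K.inner10 K.cov10 K.D_inner10, tr_cov10_inr_cov10_inl,
    tr_cov10_inl_cov10_inr_grad10]
  simp only [map_add, LinearMap.add_apply, map_smulₛₗ, starRingEnd_apply, star_scal, smul_eq_mul,
    inner10_ric10_comm]
  ring

theorem lap_inner01_grad01 (f : A) :
    K.lap (K.inner01 (K.grad01 f) (K.grad01 f)) =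
      K.tr (fun i j => K.inner01 (K.cov01 (.inl i) (K.grad01 f)) (K.cov01 (.inl j) (K.grad01 f))) +
      K.tr (fun i j => K.inner01 (K.cov01 (.inr j) (K.grad01 f)) (K.cov01 (.inr i) (K.grad01 f))) +
      K.inner01 (K.grad01 (K.lapSection f)) (K.grad01 f) +
      K.inner01 (K.grad01 f) (K.grad01 (K.lapSection f)) +
      K.scal * K.inner01 (K.grad01 f) (K.grad01 f) -
      K.inner01 (K.ric01 (K.grad01 f)) (K.grad01 f) := by
  rw [K.lap_of_metric_compatible K.inner01 K.cov01 K.D_inner01, tr_cov01_inr_cov01_inl,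
    tr_cov01_inl_cov01_inr_grad01]
  simp only [map_add, map_sub, map_smulₛₗ, starRingEnd_apply, star_scal, smul_eq_mul,
    inner01_ric01_comm]
  ring

lemma lap_add (u v : A) : K.lap (u + v) = K.lap u + K.lap v := by
  simp only [lap, map_add, tr_add]

theorem lap_normSq_grad (f : A) :
    K.lap (K.inner10 (K.grad10 f) (K.grad10 f) + K.inner01 (K.grad01 f) (K.grad01 f)) =
      K.tr (fun i j => K.inner10 (K.cov10 (.inl i) (K.grad10 f)) (K.cov10 (.inl j) (K.grad10 f)) +
        K.inner01 (K.cov01 (.inl i) (K.grad01 f)) (K.cov01 (.inl j) (K.grad01 f))) +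
      K.tr (fun i j => K.inner10 (K.cov10 (.inr j) (K.grad10 f)) (K.cov10 (.inr i) (K.grad10 f)) +
        K.inner01 (K.cov01 (.inr j) (K.grad01 f)) (K.cov01 (.inr i) (K.grad01 f))) +
      (K.inner10 (K.grad10 (K.lapSection f)) (K.grad10 f) +
        K.inner01 (K.grad01 (K.lapSection f)) (K.grad01 f)) +
      (K.inner10 (K.grad10 f) (K.grad10 (K.lapSection f)) +
        K.inner01 (K.grad01 f) (K.grad01 (K.lapSection f))) +
      K.scal * (K.inner10 (K.grad10 f) (K.grad10 f) + K.inner01 (K.grad01 f) (K.grad01 f)) +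
      K.inner10 (f • fun k => K.D (.inl k) K.scal) (K.grad10 f) +
      K.inner10 (K.grad10 f) (f • fun k => K.D (.inl k) K.scal) +
      3 * K.inner10 (K.ric10 (K.grad10 f)) (K.grad10 f) -
      K.inner01 (K.ric01 (K.grad01 f)) (K.grad01 f) := by
  rw [lap_add, lap_inner10_grad10, lap_inner01_grad01, tr_add, tr_add]
  ring

theorem scal_of_ricci_eq {μ : A} (h : ∀ i j, K.ricci i j = μ * K.g i j) :
    K.scal = Fintype.card n * μ := by
  rw [scal, funext₂ h, ← K.mul_tr μ K.g]
  simp only [tr, smul_eq_mul, sum_gInv_mul_g, Matrix.one_apply_eq, Finset.sum_const,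
    Finset.card_univ, nsmul_one, mul_comm]

theorem ric10_of_ricci_eq {μ : A} (h : ∀ i j, K.ricci i j = μ * K.g i j) (T : n → A) :
    K.ric10 T = μ • T := by
  ext j
  calc K.ric10 T j
    _ = μ * ∑ k, (∑ l, K.gInv k l * K.g j l) * T k := by
      simp only [ric10, h, tr, smul_eq_mul, Finset.mul_sum, Finset.sum_mul, mul_assoc,
        mul_left_comm μ]
    _ = μ * T j := by
      simp only [sum_gInv_mul_g, Matrix.one_apply, ite_mul, one_mul, zero_mul,
        Finset.sum_ite_eq', Finset.mem_univ, if_true]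

theorem ric01_of_ricci_eq {μ : A} (h : ∀ i j, K.ricci i j = μ * K.g i j) (T : n → A) :
    K.ric01 T = μ • T := by
  ext j
  calc K.ric01 T j
    _ = μ * ((K.g.transpose * K.gInv).mulVec T) j := by
      simp only [ric01, h, tr, smul_eq_mul, Finset.mul_sum, Matrix.mulVec, dotProduct,
        Matrix.mul_apply, Matrix.transpose_apply, Finset.sum_mul]
      rw [Finset.sum_comm]
      exact Finset.sum_congr rfl fun _ _ => Finset.sum_congr rfl fun _ _ => by ring
    _ = μ * T j := by rw [transpose_mul_gInv, Matrix.one_mulVec]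

theorem lap_normSq_grad_of_ricci_eq {μ : A} (h : ∀ i j, K.ricci i j = μ * K.g i j)
    (hμ : ∀ k, K.D (.inl k) μ = 0) (f : A) :
    K.lap (K.inner10 (K.grad10 f) (K.grad10 f) + K.inner01 (K.grad01 f) (K.grad01 f)) =
      K.tr (fun i j => K.inner10 (K.cov10 (.inl i) (K.grad10 f)) (K.cov10 (.inl j) (K.grad10 f)) +
        K.inner01 (K.cov01 (.inl i) (K.grad01 f)) (K.cov01 (.inl j) (K.grad01 f))) +
      K.tr (fun i j => K.inner10 (K.cov10 (.inr j) (K.grad10 f)) (K.cov10 (.inr i) (K.grad10 f)) +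
        K.inner01 (K.cov01 (.inr j) (K.grad01 f)) (K.cov01 (.inr i) (K.grad01 f))) +
      (K.inner10 (K.grad10 (K.lapSection f)) (K.grad10 f) +
        K.inner01 (K.grad01 (K.lapSection f)) (K.grad01 f)) +
      (K.inner10 (K.grad10 f) (K.grad10 (K.lapSection f)) +
        K.inner01 (K.grad01 f) (K.grad01 (K.lapSection f))) +
      Fintype.card n * μ *
        (K.inner10 (K.grad10 f) (K.grad10 f) + K.inner01 (K.grad01 f) (K.grad01 f)) +
      3 * μ * K.inner10 (K.grad10 f) (K.grad10 f) -
      μ * K.inner01 (K.grad01 f) (K.grad01 f) := by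
  have hscal : (fun k => K.D (.inl k) K.scal) = 0 := by
    ext k
    rw [K.scal_of_ricci_eq h, D_mul, hμ, Derivation.map_natCast, zero_mul, mul_zero, add_zero,
      Pi.zero_apply]
  rw [lap_normSq_grad, hscal, K.ric10_of_ricci_eq h, K.ric01_of_ricci_eq h, K.scal_of_ricci_eq h]
  simp only [smul_zero, map_zero, LinearMap.zero_apply, add_zero, map_smul, LinearMap.smul_apply,
    smul_eq_mul, mul_assoc]

end Calculus

end FormalKahlerMetric

/-! ### Germs of smooth functions -/

section Wirtinger

variable {m : ℕ} {u v : (Fin m → ℂ) → ℂ} {z : Fin m → ℂ}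

lemma exists_pd_eq (a : Fin m ⊕ Fin m) : ∃ (c : ℂ) (x y : Fin m → ℂ),
    ∀ u z, pd a u z = (fderiv ℝ u z x + c * fderiv ℝ u z y) / 2 := by
  rcases a with i | i
  · exact ⟨-Complex.I, Pi.single i 1, Pi.single i Complex.I, fun u z => by rw [pd]; ring⟩
  · exact ⟨Complex.I, Pi.single i 1, Pi.single i Complex.I, fun _ _ => rfl⟩

lemma pd_congr (a : Fin m ⊕ Fin m) (h : u =ᶠ[𝓝 z] v) : pd a u z = pd a v z := by
  obtain ⟨c, x, y, hp⟩ := exists_pd_eq a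
  rw [hp, hp, h.fderiv_eq]

lemma pd_const (a : Fin m ⊕ Fin m) (c : ℂ) (z : Fin m → ℂ) : pd a (fun _ => c) z = 0 := by
  obtain ⟨d, x, y, hp⟩ := exists_pd_eq a
  simp [hp]

lemma pd_add (a : Fin m ⊕ Fin m) (hu : DifferentiableAt ℝ u z) (hv : DifferentiableAt ℝ v z) :
    pd a (u + v) z = pd a u z + pd a v z := by
  obtain ⟨c, x, y, hp⟩ := exists_pd_eq a
  rw [hp, hp, hp, fderiv_add hu hv]
  simp only [add_apply]
  ring

lemma pd_mul (a : Fin m ⊕ Fin m) (hu : DifferentiableAt ℝ u z) (hv : DifferentiableAt ℝ v z) :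
    pd a (u * v) z = u z * pd a v z + v z * pd a u z := by
  obtain ⟨c, x, y, hp⟩ := exists_pd_eq a
  rw [hp, hp, hp, fderiv_mul hu hv]
  simp only [add_apply, smul_apply, smul_eq_mul]
  ring

lemma star_pd (a : Fin m ⊕ Fin m) (u : (Fin m → ℂ) → ℂ) (z : Fin m → ℂ) :
    star (pd a u z) = pd a.swap (star u) z := by
  have h (x : Fin m → ℂ) : fderiv ℝ (star u) z x = conj (fderiv ℝ u z x) :=
    congrArg (· x) (Complex.conjCLE.comp_fderiv (f := u))
  rcases a with i | i <;> simp [pd, h, sub_eq_add_neg]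

lemma contDiffAt_pd (a : Fin m ⊕ Fin m) (hu : ContDiffAt ℝ ∞ u z) :
    ContDiffAt ℝ ∞ (pd a u) z := by
  obtain ⟨c, x, y, hp⟩ := exists_pd_eq a
  have h : ContDiffAt ℝ ∞ (fderiv ℝ u) z := hu.fderiv_right le_rfl
  rw [show pd a u = fun z => (fderiv ℝ u z x + c * fderiv ℝ u z y) / 2 from funext (hp u)]
  exact ((h.clm_apply contDiffAt_const).add
    (contDiffAt_const.mul (h.clm_apply contDiffAt_const))).div_const 2

lemma pd_comm (a b : Fin m ⊕ Fin m) (hu : ContDiffAt ℝ ∞ u z) :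
    pd a (pd b u) z = pd b (pd a u) z := by
  obtain ⟨c, x, y, hp⟩ := exists_pd_eq a
  obtain ⟨d, x', y', hq⟩ := exists_pd_eq b
  have hF : DifferentiableAt ℝ (fderiv ℝ u) z :=
    (hu.fderiv_right (m := ∞) le_rfl).differentiableAt (by simp)
  have hsymm : IsSymmSndFDerivAt ℝ u z := hu.isSymmSndFDerivAt (by simpa using ENat.LEInfty.out)
  have hsnd (e : ℂ) (v v' w : Fin m → ℂ) :
      fderiv ℝ (fun z => (fderiv ℝ u z v + e * fderiv ℝ u z v') / 2) z w =
        (fderiv ℝ (fderiv ℝ u) z w v + e * fderiv ℝ (fderiv ℝ u) z w v') / 2 := by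
    have happ (v : Fin m → ℂ) := hF.hasFDerivAt.clm_apply (hasFDerivAt_const v z)
    have h := ((happ v).add ((happ v').const_mul e)).mul_const (2⁻¹ : ℂ)
    refine (congrArg (· w) (h.congr_of_eventuallyEq (.of_eq ?_)).fderiv).trans ?_
    · ext; simp [div_eq_mul_inv]
    · simp [div_eq_mul_inv, mul_comm, mul_add]
  rw [hp, hq, funext (hp u), funext (hq u), hsnd, hsnd, hsnd, hsnd, hsymm x x', hsymm x y',
    hsymm y x', hsymm y y']
  ring

end Wirtinger

section SmoothGerms

variable {E : Type*} [NormedAddCommGroup E] [NormedSpace ℝ E] {u v : E → ℂ} {z : E}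

/-- Smoothness near `z`. This is stronger than `ContDiffAt ℝ ∞ u z`, which yields for each `k` a
neighbourhood of `z` on which `u` is of class `C^k`, but not a common one. -/
def SmoothNear (u : E → ℂ) (z : E) : Prop := ∀ᶠ w in 𝓝 z, ContDiffAt ℝ ∞ u w

lemma SmoothNear.star (hu : SmoothNear u z) : SmoothNear (star u) z :=
  hu.mono fun _ h => Complex.conjCLE.contDiff.contDiffAt.comp _ h

lemma SmoothNear.inv (hu : SmoothNear u z) (h0 : u z ≠ 0) : SmoothNear u⁻¹ z := by
  filter_upwards [hu, hu.self_of_nhds.continuousAt.eventually_ne h0] with w hw hw0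
  exact hw.inv hw0

instance {α R : Type*} (l : Filter α) [NonUnitalNonAssocSemiring R] [StarRing R] :
    StarRing (Germ l R) where
  star := Germ.map star
  star_involutive x := x.inductionOn fun u => congrArg Germ.ofFun (star_star u)
  star_mul x y := x.inductionOn₂ y fun u v => congrArg Germ.ofFun (star_mul u v)
  star_add x y := x.inductionOn₂ y fun u v => congrArg Germ.ofFun (star_add u v)

variable (z) in
/-- The ring of germs at `z` of smooth complex-valued functions. -/
def smoothGerms : Subring (Germ (𝓝 z) ℂ) where
  carrier := {X | ∃ u, SmoothNear u z ∧ u = X}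
  mul_mem' := by
    rintro _ _ ⟨u, hu, rfl⟩ ⟨v, hv, rfl⟩
    exact ⟨u * v, (hu.and hv).mono fun _ h => h.1.mul h.2, rfl⟩
  one_mem' := ⟨1, .of_forall fun _ => contDiffAt_const, rfl⟩
  add_mem' := by
    rintro _ _ ⟨u, hu, rfl⟩ ⟨v, hv, rfl⟩
    exact ⟨u + v, (hu.and hv).mono fun _ h => h.1.add h.2, rfl⟩
  zero_mem' := ⟨0, .of_forall fun _ => contDiffAt_const, rfl⟩
  neg_mem' := by
    rintro _ ⟨u, hu, rfl⟩
    exact ⟨-u, hu.mono fun _ h => h.neg, rfl⟩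

instance : StarRing (smoothGerms z) where
  star X := ⟨star X.1, by
    obtain ⟨_, u, hu, rfl⟩ := X
    exact ⟨star u, hu.star, rfl⟩⟩
  star_involutive X := Subtype.ext (star_star X.1)
  star_mul X Y := Subtype.ext (star_mul X.1 Y.1)
  star_add X Y := Subtype.ext (star_add X.1 Y.1)

/-- The smooth germ `X` is the germ of the function `u`. -/
def Represents (X : smoothGerms z) (u : E → ℂ) : Prop := u = (X : Germ (𝓝 z) ℂ)

/-- The germ of a constant function. -/
def constGerm (c : ℂ) : smoothGerms z :=
  ⟨Germ.ofFun fun _ => c, fun _ => c, .of_forall fun _ => contDiffAt_const, rfl⟩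

namespace Represents

variable {X Y : smoothGerms z}

lemma exists_smoothNear (X : smoothGerms z) : ∃ u, SmoothNear u z ∧ Represents X u := X.2

lemma eventuallyEq (hu : Represents X u) (hv : Represents X v) : u =ᶠ[𝓝 z] v :=
  Germ.coe_eq.mp (hu.trans hv.symm)

lemma congr (hu : Represents X u) (h : u =ᶠ[𝓝 z] v) : Represents X v :=
  (Germ.coe_eq.mpr h).symm.trans hu

lemma const (c : ℂ) : Represents (constGerm c : smoothGerms z) (fun _ => c) := rfl

lemma natCast (k : ℕ) : Represents (k : smoothGerms z) (fun _ => (k : ℂ)) := rfl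

lemma ofNat (k : ℕ) [k.AtLeastTwo] :
    Represents (ofNat(k) : smoothGerms z) (fun _ => ofNat(k)) := rfl

lemma add (hu : Represents X u) (hv : Represents Y v) : Represents (X + Y) (u + v) :=
  congrArg₂ (· + ·) hu hv

lemma sub (hu : Represents X u) (hv : Represents Y v) : Represents (X - Y) (u - v) :=
  congrArg₂ (· - ·) hu hv

lemma neg (hu : Represents X u) : Represents (-X) (-u) :=
  congrArg Neg.neg hu

lemma mul (hu : Represents X u) (hv : Represents Y v) : Represents (X * Y) (u * v) :=
  congrArg₂ (· * ·) hu hv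

lemma star (hu : Represents X u) : Represents (star X) (star u) :=
  congrArg Star.star hu

lemma sum {ι : Type*} {s : Finset ι} {X : ι → smoothGerms z} {u : ι → E → ℂ}
    (h : ∀ i, Represents (X i) (u i)) :
    Represents (∑ i ∈ s, X i) (fun w => ∑ i ∈ s, u i w) := by
  have hsum : (fun w => ∑ i ∈ s, u i w) = ∑ i ∈ s, u i := by ext; simp
  rw [Represents, hsum, AddSubmonoidClass.coe_finsetSum]
  exact (map_sum (Germ.coeRingHom (𝓝 z)) u s).trans (Finset.sum_congr rfl fun i _ => h i)

lemma det {n : Type*} [Fintype n] [DecidableEq n] {X : Matrix n n (smoothGerms z)}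
    {u : E → Matrix n n ℂ} (h : ∀ i j, Represents (X i j) (fun w => u w i j)) :
    Represents X.det (fun w => (u w).det) := by
  let U : Matrix n n (E → ℂ) := .of fun i j w => u w i j
  have hU : (fun w => (u w).det) = U.det :=
    funext fun w => ((Pi.evalRingHom (fun _ => ℂ) w).map_det U).symm
  rw [Represents, hU]
  calc (U.det : Germ (𝓝 z) ℂ)
    _ = (U.map (Germ.coeRingHom (𝓝 z))).det := (Germ.coeRingHom (𝓝 z)).map_det U
    _ = (X.map (smoothGerms z).subtype).det := congrArg _ (Matrix.ext h)
    _ = X.det := ((smoothGerms z).subtype.map_det X).symm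

lemma nonsing_inv {n : Type*} [Fintype n] [DecidableEq n] {X : Matrix n n (smoothGerms z)}
    {u : E → Matrix n n ℂ} (h : ∀ i j, Represents (X i j) (fun w => u w i j))
    (hX : IsUnit X.det) (i j : n) : Represents (X⁻¹ i j) (fun w => (u w)⁻¹ i j) := by
  choose B _ hB using fun i j => exists_smoothNear (X⁻¹ i j)
  have hmul (i j : n) : ∀ᶠ w in 𝓝 z, ∑ k, B i k w * u w k j = (1 : Matrix n n ℂ) i j := by
    have h1 : Represents ((1 : Matrix n n (smoothGerms z)) i j)
        (fun _ => (1 : Matrix n n ℂ) i j) := by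
      rw [Matrix.one_apply, Matrix.one_apply]
      split_ifs <;> rfl
    rw [← Matrix.nonsing_inv_mul X hX] at h1
    exact (Represents.sum fun k => (hB i k).mul (h k j)).eventuallyEq h1
  refine (hB i j).congr ?_
  filter_upwards [eventually_all.mpr fun i => eventually_all.mpr (hmul i)] with w hw
  have hinv : (u w)⁻¹ = .of fun i j => B i j w := Matrix.inv_eq_left_inv (Matrix.ext hw)
  rw [hinv, Matrix.of_apply]

lemma isUnit (hu : Represents X u) (h0 : u z ≠ 0) : IsUnit X := by
  obtain ⟨v, hv, hXv⟩ := exists_smoothNear X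
  have hv0 : v z ≠ 0 := (hXv.eventuallyEq hu).eq_of_nhds ▸ h0
  refine .of_mul_eq_one ⟨_, v⁻¹, hv.inv hv0, rfl⟩ (Subtype.ext ?_)
  refine (congrArg (· * _) hXv.symm).trans (Germ.coe_eq.mpr ?_)
  filter_upwards [hv.self_of_nhds.continuousAt.eventually_ne hv0] with w hw
  exact mul_inv_cancel₀ hw

end Represents

end SmoothGerms

section WirtingerGerms

variable {m : ℕ} {u : (Fin m → ℂ) → ℂ} {z : Fin m → ℂ}

lemma SmoothNear.pd (a : Fin m ⊕ Fin m) (hu : SmoothNear u z) : SmoothNear (pd a u) z :=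
  hu.mono fun _ => contDiffAt_pd a

lemma eventuallyEq_pd (a : Fin m ⊕ Fin m) {u v : (Fin m → ℂ) → ℂ} (h : u =ᶠ[𝓝 z] v) :
    pd a u =ᶠ[𝓝 z] pd a v :=
  h.eventually_nhds.mono fun _ => pd_congr a

/-- The Wirtinger derivative `pd a` of smooth germs. -/
def pdGerm (a : Fin m ⊕ Fin m) (X : smoothGerms z) : smoothGerms z :=
  ⟨Germ.map' (pd a) (fun _ _ => eventuallyEq_pd a) X.1, by
    obtain ⟨_, u, hu, rfl⟩ := X
    exact ⟨pd a u, hu.pd a, rfl⟩⟩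

lemma Represents.pdGerm {X : smoothGerms z} (hu : Represents X u) (a : Fin m ⊕ Fin m) :
    Represents (pdGerm a X) (pd a u) :=
  congrArg (Germ.map' (KahlerBochner.pd a) fun _ _ => eventuallyEq_pd a) hu

lemma Represents.ext {X Y : smoothGerms z} {v : (Fin m → ℂ) → ℂ} (hu : Represents X u)
    (hv : Represents Y v) (h : u =ᶠ[𝓝 z] v) : X = Y :=
  Subtype.ext ((hu.congr h).symm.trans hv)

lemma pdGerm_add (a : Fin m ⊕ Fin m) (X Y : smoothGerms z) :
    pdGerm a (X + Y) = pdGerm a X + pdGerm a Y := by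
  obtain ⟨u, hu, hX⟩ := Represents.exists_smoothNear X
  obtain ⟨v, hv, hY⟩ := Represents.exists_smoothNear Y
  refine ((hX.add hY).pdGerm a).ext ((hX.pdGerm a).add (hY.pdGerm a)) ?_
  filter_upwards [hu, hv] with w hu hv
  exact pd_add a (hu.differentiableAt (by simp)) (hv.differentiableAt (by simp))

lemma pdGerm_mul (a : Fin m ⊕ Fin m) (X Y : smoothGerms z) :
    pdGerm a (X * Y) = X * pdGerm a Y + Y * pdGerm a X := by
  obtain ⟨u, hu, hX⟩ := Represents.exists_smoothNear X
  obtain ⟨v, hv, hY⟩ := Represents.exists_smoothNear Y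
  refine ((hX.mul hY).pdGerm a).ext ((hX.mul (hY.pdGerm a)).add (hY.mul (hX.pdGerm a))) ?_
  filter_upwards [hu, hv] with w hu hv
  exact pd_mul a (hu.differentiableAt (by simp)) (hv.differentiableAt (by simp))

/-- The Wirtinger derivative as a derivation of the ring of smooth germs. -/
def pdDerivation (a : Fin m ⊕ Fin m) : Derivation ℤ (smoothGerms z) (smoothGerms z) :=
  .mk' (AddMonoidHom.mk' (pdGerm a) (pdGerm_add a)).toIntLinearMap (pdGerm_mul a)

lemma Represents.pdDerivation {X : smoothGerms z} (hu : Represents X u) (a : Fin m ⊕ Fin m) :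
    Represents (pdDerivation a X) (pd a u) :=
  hu.pdGerm a

lemma pdDerivation_comm (a b : Fin m ⊕ Fin m) (X : smoothGerms z) :
    pdDerivation a (pdDerivation b X) = pdDerivation b (pdDerivation a X) := by
  obtain ⟨u, hu, hX⟩ := Represents.exists_smoothNear X
  exact ((hX.pdDerivation b).pdDerivation a).ext ((hX.pdDerivation a).pdDerivation b)
    (hu.mono fun _ => pd_comm a b)

lemma star_pdDerivation (a : Fin m ⊕ Fin m) (X : smoothGerms z) :
    star (pdDerivation a X) = pdDerivation a.swap (star X) := by
  obtain ⟨u, -, hX⟩ := Represents.exists_smoothNear X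
  exact (hX.pdDerivation a).star.ext (hX.star.pdDerivation a.swap) (.of_forall (star_pd a u))

lemma pdDerivation_constGerm (a : Fin m ⊕ Fin m) (c : ℂ) :
    pdDerivation a (constGerm c : smoothGerms z) = 0 :=
  ((Represents.const c).pdDerivation a).ext (v := fun _ => 0) rfl (.of_forall (pd_const a c))

end WirtingerGerms

/-! ### Local coordinates -/

/-- A smooth pseudo-Kähler metric on a neighbourhood of the point `z`, in coordinates: the
Hermitian matrix `(g_{i j̄})` is nondegenerate but need not be positive definite. -/
structure IsPseudoKahlerAt {m : ℕ} (G : LocalMetric m) (z : Fin m → ℂ) : Prop where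
  smooth : ∀ i j, SmoothNear (fun w => G w i j) z
  isHermitian : ∀ᶠ w in 𝓝 z, (G w).IsHermitian
  det_ne_zero : (G z).det ≠ 0
  closed : ∀ i j k, ∀ᶠ w in 𝓝 z,
    pd (.inl k) (fun w => G w i j) w = pd (.inl i) (fun w => G w k j) w

namespace IsPseudoKahlerAt

variable {m : ℕ} {G : LocalMetric m} {z : Fin m → ℂ} (hG : IsPseudoKahlerAt G z)

/-- The germ of the entry `g_{i j̄}` of the metric. -/
def metricGerm (i j : Fin m) : smoothGerms z :=
  ⟨Germ.ofFun fun w => G w i j, _, hG.smooth i j, rfl⟩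

lemma represents_metricGerm (i j : Fin m) :
    Represents (hG.metricGerm i j) (fun w => G w i j) :=
  rfl

/-- The germ at `z` of the metric. -/
def toFormal : FormalKahlerMetric (Fin m) (smoothGerms z) where
  D := pdDerivation
  D_comm := pdDerivation_comm
  star_D := star_pdDerivation
  g := .of hG.metricGerm
  isHermitian := Matrix.ext fun i j =>
    (hG.represents_metricGerm j i).star.ext (hG.represents_metricGerm i j)
      (hG.isHermitian.mono fun _ h => h.apply i j)
  isUnit_det := (Represents.det hG.represents_metricGerm).isUnit hG.det_ne_zero
  closed i j k := ((hG.represents_metricGerm i j).pdDerivation _).ext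
    ((hG.represents_metricGerm k j).pdDerivation _) (hG.closed i j k)

lemma represents_g (i j : Fin m) : Represents (hG.toFormal.g i j) (fun w => G w i j) :=
  rfl

lemma represents_D {X : smoothGerms z} {u : (Fin m → ℂ) → ℂ} (h : Represents X u)
    (a : Fin m ⊕ Fin m) : Represents (hG.toFormal.D a X) (pd a u) :=
  h.pdDerivation a

lemma represents_gInv (i j : Fin m) : Represents (hG.toFormal.gInv i j) (gUp G i j) :=
  Represents.nonsing_inv hG.represents_g hG.toFormal.isUnit_det j i

lemma represents_normSq : Represents hG.toFormal.normSq (normSqFrame G) := by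
  refine (Represents.det (u := fun w => (G w)⁻¹.transpose) hG.represents_gInv).congr (.of_eq ?_)
  ext w
  rw [Matrix.det_transpose, Matrix.det_nonsing_inv, Ring.inverse_eq_inv', normSqFrame]

lemma represents_tr {X : Fin m → Fin m → smoothGerms z} {u : Fin m → Fin m → (Fin m → ℂ) → ℂ}
    (h : ∀ i j, Represents (X i j) (u i j)) :
    Represents (hG.toFormal.tr X) (fun w => ∑ i, ∑ j, gUp G i j w * u i j w) :=
  .sum fun i => .sum fun j => (hG.represents_gInv i j).mul (h i j)

lemma represents_chr (i j k : Fin m) : Represents (hG.toFormal.chr i j k) (christoffel G i j k) :=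
  .sum fun l => (hG.represents_gInv i l).mul (hG.represents_D (hG.represents_g j l) (.inl k))

lemma represents_chrTr (i : Fin m) : Represents (hG.toFormal.chrTr i) (connK G (.inl i)) :=
  .sum fun k => hG.represents_chr k i k

lemma represents_ricci (i j : Fin m) : Represents (hG.toFormal.ricci i j) (ricci G i j) :=
  .sum fun k => (hG.represents_D (hG.represents_chr k i k) (.inr j)).neg

lemma represents_scal : Represents hG.toFormal.scal (scalarCurv G) :=
  hG.represents_tr hG.represents_ricci

lemma ricci_toFormal_eq {μ : ℂ} (hμ : ∀ᶠ w in 𝓝 z, ∀ i j, ricci G i j w = μ * G w i j)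
    (i j : Fin m) : hG.toFormal.ricci i j = constGerm μ * hG.toFormal.g i j :=
  (hG.represents_ricci i j).ext ((Represents.const μ).mul (hG.represents_g i j))
    (hμ.mono fun _ h => h i j)

include hG in
lemma scalarCurv_of_ricci_eq {μ : ℂ}
    (hμ : ∀ᶠ w in 𝓝 z, ∀ i j, ricci G i j w = μ * G w i j) : scalarCurv G z = m * μ := by
  have hscal := hG.toFormal.scal_of_ricci_eq (hG.ricci_toFormal_eq hμ)
  rw [Fintype.card_fin] at hscal
  exact (hG.represents_scal.eventuallyEq
    (hscal ▸ (Represents.natCast m).mul (.const μ))).eq_of_nhds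

lemma represents_lap {X : smoothGerms z} {u : (Fin m → ℂ) → ℂ} (h : Represents X u) :
    Represents (hG.toFormal.lap X) (laplacian G u) :=
  hG.represents_tr fun i j => hG.represents_D (hG.represents_D h (.inr j)) (.inl i)

end IsPseudoKahlerAt

lemma inner₂_eq {m : ℕ} (G : LocalMetric m)
    (p q : Fin m ⊕ Fin m → Fin m ⊕ Fin m → (Fin m → ℂ) → ℂ) (w : Fin m → ℂ) :
    inner₂ G p q w = ∑ a, ∑ b, gUpC G a b w * inner₁ G (p a) (q b) w := by
  simp only [inner₂, inner₁, Finset.mul_sum]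
  refine Finset.sum_congr rfl fun a _ => ?_
  rw [Finset.sum_comm]
  exact Finset.sum_congr rfl fun c _ => Finset.sum_congr rfl fun b _ =>
    Finset.sum_congr rfl fun d _ => by ring

lemma represents_part10 {m : ℕ} {z : Fin m → ℂ} {S : Fin m → smoothGerms z}
    {s : Fin m ⊕ Fin m → (Fin m → ℂ) → ℂ} (hS : ∀ i, Represents (S i) (s (.inl i))) :
    ∀ a, Represents (Sum.elim S 0 a) (part10 s a)
  | .inl i => hS i
  | .inr _ => rfl

lemma represents_part01 {m : ℕ} {z : Fin m → ℂ} {S : Fin m → smoothGerms z}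
    {s : Fin m ⊕ Fin m → (Fin m → ℂ) → ℂ} (hS : ∀ i, Represents (S i) (s (.inr i))) :
    ∀ a, Represents (Sum.elim 0 S a) (part01 s a)
  | .inl _ => rfl
  | .inr i => hS i

namespace IsPseudoKahlerAt

variable {m : ℕ} {G : LocalMetric m} {z : Fin m → ℂ} (hG : IsPseudoKahlerAt G z)

variable {S S' T T' : Fin m → smoothGerms z} {s t : Fin m ⊕ Fin m → (Fin m → ℂ) → ℂ}
  {X : smoothGerms z} {f : (Fin m → ℂ) → ℂ}

include hG

lemma represents_tr_swap {X : Fin m → Fin m → smoothGerms z}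
    {u : Fin m → Fin m → (Fin m → ℂ) → ℂ} (h : ∀ i j, Represents (X i j) (u i j)) :
    Represents (hG.toFormal.tr fun i j => X j i)
      (fun w => ∑ i, ∑ j, conj (gUp G i j w) * u i j w) := by
  rw [FormalKahlerMetric.tr_swap]
  exact .sum fun i => .sum fun j => (hG.represents_gInv i j).star.mul (h i j)

lemma represents_inner₁ (hS : ∀ a, Represents (Sum.elim S S' a) (s a))
    (hT : ∀ a, Represents (Sum.elim T T' a) (t a)) :
    Represents (hG.toFormal.inner10 S T + hG.toFormal.inner01 S' T') (inner₁ G s t) := by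
  have h10 := hG.represents_tr fun i j => (hS (.inl i)).mul (hT (.inl j)).star
  have h01 := hG.represents_tr_swap fun i j => (hS (.inr i)).mul (hT (.inr j)).star
  rw [FormalKahlerMetric.inner10_apply, FormalKahlerMetric.inner01_apply, ← mul_add]
  refine (hG.represents_normSq.mul (h10.add h01)).congr (.of_eq ?_)
  ext w
  simp [inner₁, gUpC, Fintype.sum_sum_type, mul_assoc]

lemma represents_nabla (hf : Represents X f) (a : Fin m ⊕ Fin m) :
    Represents (Sum.elim (hG.toFormal.grad10 X) (hG.toFormal.grad01 X) a) (nabla G f a) := by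
  rcases a with i | i
  · exact (hG.represents_D hf (.inl i)).sub ((hG.represents_chrTr i).mul hf)
  · refine (hG.represents_D hf (.inr i)).congr (.of_eq ?_)
    ext w
    simp [nabla, connK, christoffelC]

lemma represents_nabla₁ (hS : ∀ a, Represents (Sum.elim S S' a) (s a)) (a b : Fin m ⊕ Fin m) :
    Represents (Sum.elim (hG.toFormal.cov10 a S) (hG.toFormal.cov01 a S') b)
      (nabla₁ G s a b) := by
  have hD := hG.represents_D (hS b) a
  rcases a with i | i <;> rcases b with j | j
  · refine ((hD.sub ((hG.represents_chrTr i).mul (hS (.inl j)))).sub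
      (.sum fun c => (hG.represents_chr c i j).mul (hS (.inl c)))).congr (.of_eq ?_)
    ext w
    simp [nabla₁, christoffelC, Fintype.sum_sum_type]
  · refine (hD.sub ((hG.represents_chrTr i).mul (hS (.inr j)))).congr (.of_eq ?_)
    ext w
    simp [nabla₁, christoffelC]
  · refine hD.congr (.of_eq ?_)
    ext w
    simp [nabla₁, connK, christoffelC]
  · refine (hD.sub
      (.sum fun c => (hG.represents_chr c i j).star.mul (hS (.inr c)))).congr (.of_eq ?_)
    ext w
    simp [nabla₁, connK, christoffelC, Fintype.sum_sum_type]

lemma represents_nablaSq (hf : Represents X f) (a b : Fin m ⊕ Fin m) :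
    Represents (Sum.elim (hG.toFormal.cov10 a (hG.toFormal.grad10 X))
      (hG.toFormal.cov01 a (hG.toFormal.grad01 X)) b) (nablaSq G f a b) :=
  hG.represents_nabla₁ (hG.represents_nabla hf) a b

lemma represents_lapSection (hf : Represents X f) :
    Represents (hG.toFormal.lapSection X) (laplacianK G f) :=
  hG.represents_tr fun i j => hG.represents_nablaSq hf (.inl i) (.inr j)

lemma represents_ricciAct (hS : ∀ a, Represents (Sum.elim S S' a) (s a)) (a : Fin m ⊕ Fin m) :
    Represents (Sum.elim (hG.toFormal.ric10 S) (hG.toFormal.ric01 S') a) (ricciAct G s a) := by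
  rcases a with j | j
  · refine (hG.represents_tr fun k l =>
      (hG.represents_ricci j l).mul (hS (.inl k))).congr (.of_eq ?_)
    ext w
    simp [ricciAct, mul_left_comm, mul_assoc]
  · refine (hG.represents_tr fun k l =>
      (hG.represents_ricci k j).mul (hS (.inr l))).congr (.of_eq ?_)
    ext w
    simp [ricciAct, mul_left_comm, mul_assoc]

lemma represents_mulGradScalar (hf : Represents X f) (a : Fin m ⊕ Fin m) :
    Represents (X * hG.toFormal.D a hG.toFormal.scal) (mulGradScalar G f a) :=
  hf.mul (hG.represents_D hG.represents_scal a)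

lemma represents_inner₂ {P P' Q Q' : Fin m ⊕ Fin m → Fin m → smoothGerms z}
    {p q : Fin m ⊕ Fin m → Fin m ⊕ Fin m → (Fin m → ℂ) → ℂ}
    (hp : ∀ a b, Represents (Sum.elim (P a) (P' a) b) (p a b))
    (hq : ∀ a b, Represents (Sum.elim (Q a) (Q' a) b) (q a b)) :
    Represents
      (hG.toFormal.tr (fun i j => hG.toFormal.inner10 (P (.inl i)) (Q (.inl j)) +
          hG.toFormal.inner01 (P' (.inl i)) (Q' (.inl j))) +
        hG.toFormal.tr (fun i j => hG.toFormal.inner10 (P (.inr j)) (Q (.inr i)) +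
          hG.toFormal.inner01 (P' (.inr j)) (Q' (.inr i))))
      (inner₂ G p q) := by
  have h10 := hG.represents_tr fun i j => hG.represents_inner₁ (hp (.inl i)) (hq (.inl j))
  have h01 := hG.represents_tr_swap fun i j => hG.represents_inner₁ (hp (.inr i)) (hq (.inr j))
  refine (h10.add h01).congr (.of_eq ?_)
  ext w
  simp [inner₂_eq, gUpC, Fintype.sum_sum_type]

lemma represents_inner₁_part10 (hS : ∀ i, Represents (S i) (s (.inl i)))
    (hT : ∀ i, Represents (T i) (t (.inl i))) :
    Represents (hG.toFormal.inner10 S T) (inner₁ G (part10 s) (part10 t)) := by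
  simpa using hG.represents_inner₁ (represents_part10 hS) (represents_part10 hT)

lemma represents_inner₁_part01 (hS : ∀ i, Represents (S i) (s (.inr i)))
    (hT : ∀ i, Represents (T i) (t (.inr i))) :
    Represents (hG.toFormal.inner01 S T) (inner₁ G (part01 s) (part01 t)) := by
  simpa using hG.represents_inner₁ (represents_part01 hS) (represents_part01 hT)

lemma represents_ricciForm_part10 (hS : ∀ i, Represents (S i) (s (.inl i)))
    (hT : ∀ i, Represents (T i) (t (.inl i))) :
    Represents (hG.toFormal.inner10 (hG.toFormal.ric10 S) T)
      (ricciForm G (part10 s) (part10 t)) := by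
  have h := hG.represents_inner₁ (hG.represents_ricciAct (represents_part10 hS))
    (represents_part10 hT)
  rw [map_zero, add_zero] at h
  exact h

lemma represents_ricciForm_part01 (hS : ∀ i, Represents (S i) (s (.inr i)))
    (hT : ∀ i, Represents (T i) (t (.inr i))) :
    Represents (hG.toFormal.inner01 (hG.toFormal.ric01 S) T)
      (ricciForm G (part01 s) (part01 t)) := by
  have h := hG.represents_inner₁ (hG.represents_ricciAct (represents_part01 hS))
    (represents_part01 hT)
  rw [map_zero, zero_add] at h
  exact h

end IsPseudoKahlerAt

/-! ### Kähler manifolds -/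

section KahlerManifold

variable {m : ℕ} {M : Type*} [TopologicalSpace M] [ChartedSpace (Fin m → ℂ) M]
  {e : OpenPartialHomeomorph M (Fin m → ℂ)} {z : Fin m → ℂ}

lemma linearIndependent_coordVec [IsManifold 𝓘(ℂ, Fin m → ℂ) ω M] (he : e ∈ holoCharts m M)
    (hz : z ∈ e.target) : LinearIndependent ℂ (coordVec e z) := by
  have he1 : e ∈ IsManifold.maximalAtlas 𝓘(ℂ, Fin m → ℂ) 1 M :=
    IsManifold.maximalAtlas_subset_of_le (by simp) he
  have hd : e.MDifferentiable 𝓘(ℂ, Fin m → ℂ) 𝓘(ℂ, Fin m → ℂ) :=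
    ⟨fun x hx => (mdifferentiableAt_of_mem_maximalAtlas he1 hx).mdifferentiableWithinAt,
      fun x hx => (mdifferentiableAt_symm_of_mem_maximalAtlas he1 hx).mdifferentiableWithinAt⟩
  exact (Pi.linearIndependent_single_one (Fin m) ℂ).map' _
    (LinearMap.ker_eq_bot.mpr (hd.symm.mfderiv_injective hz))

lemma det_gram_ne_zero {V : Type*} [AddCommGroup V] [Module ℂ V] {h : V →ₗ[ℂ] V →ₗ⋆[ℂ] ℂ}
    (hpos : ∀ v, v ≠ 0 → 0 < (h v v).re) {n : Type*} [Fintype n] [DecidableEq n] {b : n → V}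
    (hb : LinearIndependent ℂ b) : (Matrix.of fun i j => h (b i) (b j)).det ≠ 0 := by
  intro hdet
  obtain ⟨v, hv0, hv⟩ := Matrix.exists_vecMul_eq_zero_iff.mpr hdet
  have hne : ∑ i, v i • b i ≠ 0 := fun h0 =>
    hv0 (funext (Fintype.linearIndependent_iff.mp hb v h0))
  have hzero (j : n) : h (∑ i, v i • b i) (b j) = 0 := by
    simpa [Matrix.vecMul, dotProduct, LinearMap.sum_apply] using congrFun hv j
  refine (hpos _ hne).ne' ?_
  rw [map_sum, Finset.sum_eq_zero fun j _ => by rw [map_smulₛₗ, hzero, smul_zero], Complex.zero_re]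

lemma smoothNear_of_contDiffOn {E : Type*} [NormedAddCommGroup E] [NormedSpace ℝ E] {u : E → ℂ}
    {s : Set E} {z : E} (hu : ContDiffOn ℝ ∞ u s) (hs : IsOpen s) (hz : z ∈ s) :
    SmoothNear u z :=
  eventually_of_mem (hs.mem_nhds hz) fun _ hw => hu.contDiffAt (hs.mem_nhds hw)

lemma KahlerMetric.isPseudoKahlerAt [IsManifold 𝓘(ℂ, Fin m → ℂ) ω M] (g : KahlerMetric m M)
    (he : e ∈ holoCharts m M) (hz : z ∈ e.target) : IsPseudoKahlerAt (g.inChart e) z where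
  smooth i j := smoothNear_of_contDiffOn (g.smooth e he i j) e.open_target hz
  isHermitian := .of_forall fun _ => Matrix.ext fun _ _ => g.conj_symm _ _ _
  det_ne_zero := det_gram_ne_zero (g.pos _) (linearIndependent_coordVec he hz)
  closed i j k := eventually_of_mem (e.open_target.mem_nhds hz) fun w hw => g.closed e he w hw i j k

end KahlerManifold

end KahlerBochner

end

theorem lemma2p1_general {m : ℕ} {G : LocalMetric m} {f : (Fin m → ℂ) → ℂ} {z : Fin m → ℂ}
    (hG : IsPseudoKahlerAt G z) (hf : SmoothNear f z) :
    (laplacian G (inner₁ G (nabla G f) (nabla G f)) z =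
      inner₂ G (nablaSq G f) (nablaSq G f) z
      + inner₁ G (nabla G (laplacianK G f)) (nabla G f) z
      + inner₁ G (nabla G f) (nabla G (laplacianK G f)) z
      + scalarCurv G z * inner₁ G (nabla G f) (nabla G f) z
      + inner₁ G (part10 (mulGradScalar G f)) (part10 (nabla G f)) z
      + inner₁ G (part10 (nabla G f)) (part10 (mulGradScalar G f)) z
      + 3 * ricciForm G (part10 (nabla G f)) (part10 (nabla G f)) z
      - ricciForm G (part01 (nabla G f)) (part01 (nabla G f)) z) ∧
    ∀ μ : ℂ, (∀ᶠ w in nhds z, ∀ i j, ricci G i j w = μ * G w i j) →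
      scalarCurv G z = m * μ ∧
      laplacian G (inner₁ G (nabla G f) (nabla G f)) z =
        inner₂ G (nablaSq G f) (nablaSq G f) z
        + inner₁ G (nabla G (laplacianK G f)) (nabla G f) z
        + inner₁ G (nabla G f) (nabla G (laplacianK G f)) z
        + m * μ * inner₁ G (nabla G f) (nabla G f) z
        + 3 * μ * inner₁ G (part10 (nabla G f)) (part10 (nabla G f)) z
        - μ * inner₁ G (part01 (nabla G f)) (part01 (nabla G f)) z := by
  have hX : Represents ⟨f, f, hf, rfl⟩ f := rfl
  have hgrad := hG.represents_nabla hX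
  have hgrad10 i := hgrad (.inl i)
  have hgrad01 i := hgrad (.inr i)
  have hgradLap := hG.represents_nabla (hG.represents_lapSection hX)
  have hgradScal i := hG.represents_mulGradScalar hX (.inl i)
  have hlhs := hG.represents_lap (hG.represents_inner₁ hgrad hgrad)
  have hrhs := hG.represents_inner₂ (hG.represents_nablaSq hX) (hG.represents_nablaSq hX)
    |>.add (hG.represents_inner₁ hgradLap hgrad)
    |>.add (hG.represents_inner₁ hgrad hgradLap)
  refine ⟨?_, fun μ hμ => ⟨hG.scalarCurv_of_ricci_eq hμ, ?_⟩⟩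
  · rw [FormalKahlerMetric.lap_normSq_grad] at hlhs
    exact (hlhs.eventuallyEq <| hrhs
      |>.add (hG.represents_scal.mul (hG.represents_inner₁ hgrad hgrad))
      |>.add (hG.represents_inner₁_part10 hgradScal hgrad10)
      |>.add (hG.represents_inner₁_part10 hgrad10 hgradScal)
      |>.add (.mul (.ofNat 3) (hG.represents_ricciForm_part10 hgrad10 hgrad10))
      |>.sub (hG.represents_ricciForm_part01 hgrad01 hgrad01)).eq_of_nhds
  · rw [hG.toFormal.lap_normSq_grad_of_ricci_eq (hG.ricci_toFormal_eq hμ)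
      fun k => pdDerivation_constGerm _ μ, Fintype.card_fin] at hlhs
    exact (hlhs.eventuallyEq <| hrhs
      |>.add (.mul (.mul (.natCast m) (.const μ)) (hG.represents_inner₁ hgrad hgrad))
      |>.add (.mul (.mul (.ofNat 3) (.const μ)) (hG.represents_inner₁_part10 hgrad10 hgrad10))
      |>.sub (.mul (.const μ) (hG.represents_inner₁_part01 hgrad01 hgrad01))).eq_of_nhds

theorem lemma2p1 {m : ℕ} {M : Type*} [TopologicalSpace M] [ChartedSpace (Fin m → ℂ) M]
    [IsManifold 𝓘(ℂ, Fin m → ℂ) ω M] (g : KahlerMetric m M) (φ : TopForm m M) :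
    -- the general formula, in every holomorphic chart and at every point of it
    (∀ e ∈ holoCharts m M, ∀ z ∈ e.target,
      let G := g.inChart e
      let f := φ.coeff e
      laplacian G (inner₁ G (nabla G f) (nabla G f)) z =
        inner₂ G (nablaSq G f) (nablaSq G f) z
        + inner₁ G (nabla G (laplacianK G f)) (nabla G f) z
        + inner₁ G (nabla G f) (nabla G (laplacianK G f)) z
        + scalarCurv G z * inner₁ G (nabla G f) (nabla G f) z
        + inner₁ G (part10 (mulGradScalar G f)) (part10 (nabla G f)) z
        + inner₁ G (part10 (nabla G f)) (part10 (mulGradScalar G f)) z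
        + 3 * ricciForm G (part10 (nabla G f)) (part10 (nabla G f)) z
        - ricciForm G (part01 (nabla G f)) (part01 (nabla G f)) z) ∧
    -- the Kähler–Einstein case
    (∀ μ : ℝ, g.IsEinstein μ → ∀ e ∈ holoCharts m M, ∀ z ∈ e.target,
      let G := g.inChart e
      let f := φ.coeff e
      scalarCurv G z = (m : ℂ) * μ ∧
      laplacian G (inner₁ G (nabla G f) (nabla G f)) z =
        inner₂ G (nablaSq G f) (nablaSq G f) z
        + inner₁ G (nabla G (laplacianK G f)) (nabla G f) z
        + inner₁ G (nabla G f) (nabla G (laplacianK G f)) z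
        + (m : ℂ) * μ * inner₁ G (nabla G f) (nabla G f) z
        + 3 * μ * inner₁ G (part10 (nabla G f)) (part10 (nabla G f)) z
        - μ * inner₁ G (part01 (nabla G f)) (part01 (nabla G f)) z) ∧
    -- the Calabi–Yau case
    (g.IsEinstein 0 → ∀ e ∈ holoCharts m M, ∀ z ∈ e.target,
      let G := g.inChart e
      let f := φ.coeff e
      laplacian G (inner₁ G (nabla G f) (nabla G f)) z =
        inner₂ G (nablaSq G f) (nablaSq G f) z
        + inner₁ G (nabla G (laplacianK G f)) (nabla G f) z
        + inner₁ G (nabla G f) (nabla G (laplacianK G f)) z) := by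
  have general (e) (he : e ∈ holoCharts m M) (z) (hz : z ∈ e.target) :=
    lemma2p1_general (f := φ.coeff e) (g.isPseudoKahlerAt he hz)
      (smoothNear_of_contDiffOn (φ.smooth e he) e.open_target hz)
  have einstein (μ : ℝ) (hμ : g.IsEinstein μ) (e) (he : e ∈ holoCharts m M) (z)
      (hz : z ∈ e.target) := (general e he z hz).2 μ
    (Filter.eventually_of_mem (e.open_target.mem_nhds hz) (hμ e he))
  refine ⟨fun e he z hz => (general e he z hz).1, einstein, fun h0 e he z hz => ?_⟩
  simpa using (einstein 0 h0 e he z hz).2
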